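/- Let $K/F$ be a CM extension of number fields ($F$ totally real, $K$ totally complex, $[K:F]=2$), and suppose that $2$ splits completely in $F$. Let $S=\det_H(\mathcal O_K,\mathrm{Norm}_{K/F})\in \mathbb A_{F,\mathbf f}^\times/(U_{\mathbf f})^2$, with $U_{\mathbf f}=\prod_{\mathfrak p}\mathcal O_{\mathfrak p}^\times$, be the Hessian determinant squareclass of the quadratic $\mathcal O_F$-lattice $\mathcal O_K$ with the norm form: its component $S_{\mathfrak p}$ is the class modulo $(\mathcal O_{\mathfrak p}^\times)^2$ of the determinant of the Hessian matrix $\big(\partial^2 \mathrm{Norm}_{K/F}/\partial x_i\partial x_j\big)$ in an $\mathcal O_{\mathfrak p}$-basis of $\mathcal O_K\otimes_{\mathcal O_F}\mathcal O_{\mathfrak p}$. Let $\mathfrak I(S)=\prod_{\mathfrak p}\mathfrak p^{\mathrm{ord}_{\mathfrak p}(S_{\mathfrak p})}$. Let $\mu_K$ be the group of roots of unity in $K$, $h$ the class number, $\Delta_F$ the absolute discriminant, and $Q_{K/F}=[\mathcal O_K^\times:\mu_K\mathcal O_F^\times]$. Let $\chi_{K/F}$ be the quadratic Hecke character attached to $K/F$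 by class field theory: $\chi_{K/F}(\mathfrak p)\in\{\pm1\}$ is the Artin symbol of $\mathfrak p$ in $\mathrm{Gal}(K/F)\cong\{\pm1\}$ for $\mathfrak p$ unramified in $K$, and $\chi_{K/F}(\mathfrak p)=0$ for $\mathfrak p$ ramified in $K$. Let $L_F(s,\chi_{K/F})=\prod_{\mathfrak p}(1-\chi_{K/F}(\mathfrak p)N(\mathfrak p)^{-s})^{-1}$ for $\mathrm{Re}\,s>1$, where the product converges, and $L_F(1,\chi_{K/F})=\lim_{s\to1^+}L_F(s,\chi_{K/F})$, which exists. Then $Q_{K/F}\in\{1,2\}$ and $$h(\mathcal O_K)=\frac{|\mu_K|\cdot h(\mathcal O_F)\cdot|\Delta_F|^{1/2}\cdot Q_{K/F}\cdot N_{F/\mathbb Q}(\mathfrak I(S))^{1/2}}{(2\pi)^{[F:\mathbb Q]}}\cdot L_F(1,\chi_{K/F}).$$ When $F=\mathbb Q$, so that $K$ is an imaginary quadratic field with discriminant $\Delta_K$, we have $h(\mathcal O_F)=Q_{K/F}=1$, $N(\mathfrak I(S))=|\Delta_K|$, and $L_{\mathbb Q}(1,\chi_{K/\mathbb Q})=L(1,\chi)$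 for the Dirichlet character $\chi$ modulo $|\Delta_K|$ given by the Kronecker symbol $n\mapsto\left(\frac{\Delta_K}{n}\right)$ $(n\ge1)$, so that the formula becomes Dirichlet's class number formula $$h(\mathcal O_K)=\frac{|\mu_K|\cdot|\Delta_K|^{1/2}}{2\pi}\,L(1,\chi).$$ -/

import Mathlib

open NumberField IsDedekindDomain Module Topology
open scoped TensorProduct

namespace CMClassNumber

noncomputable section

/-! ### Squareclasses -/

section Squareclass

/-- The group `SqCl(G, H) = G / H²` of `H`-squareclasses of an abelian group `G`. -/
abbrev SqCl (G : Type*) [CommGroup G] (H : Subgroup G) : Type _ :=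
  G ⧸ H.map (powMonoidHom 2)

variable {F : Type*} [Field F] [NumberField F]

/-- The group of units `𝒪_𝔭ˣ` inside `F_𝔭ˣ`. -/
def localUnits (𝔭 : HeightOneSpectrum (𝓞 F)) : Subgroup (𝔭.adicCompletion F)ˣ where
  carrier := {u | Valued.v (u : 𝔭.adicCompletion F) = 1}
  mul_mem' {a b} ha hb := by
    simp only [Set.mem_ofPred_eq] at ha hb ⊢
    simp [ha, hb]
  one_mem' := by simp
  inv_mem' {a} ha := by
    simp only [Set.mem_ofPred_eq] at ha ⊢
    simp [ha]

/-- The projection `𝔸_{F,f} → F_𝔭`. -/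
def adeleEval (𝔭 : HeightOneSpectrum (𝓞 F)) :
    FiniteAdeleRing (𝓞 F) F →+* 𝔭.adicCompletion F where
  toFun a := a 𝔭
  map_one' := rfl
  map_mul' _ _ := rfl
  map_zero' := rfl
  map_add' _ _ := rfl

/-- The projection `𝔸_{F,f}ˣ → F_𝔭ˣ`. -/
def ideleEval (𝔭 : HeightOneSpectrum (𝓞 F)) :
    (FiniteAdeleRing (𝓞 F) F)ˣ →* (𝔭.adicCompletion F)ˣ :=
  Units.map (adeleEval 𝔭).toMonoidHom

variable (F) in
/-- The subgroup `U_f = ∏_𝔭 𝒪_𝔭ˣ` of the finite ideles. -/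
def integralIdeles : Subgroup (FiniteAdeleRing (𝓞 F) F)ˣ :=
  ⨅ 𝔭, (localUnits 𝔭).comap (ideleEval 𝔭)

variable (F) in
/-- The group `SqCl(𝔸_{F,f}ˣ, U_f)` of non-archimedean integral squareclasses. -/
abbrev IdeleSqCl : Type _ := SqCl (FiniteAdeleRing (𝓞 F) F)ˣ (integralIdeles F)

/-- The component `S_𝔭 ∈ SqCl(F_𝔭ˣ, 𝒪_𝔭ˣ)` of a non-archimedean squareclass `S`. -/
def component (𝔭 : HeightOneSpectrum (𝓞 F)) :
    IdeleSqCl F →* SqCl (𝔭.adicCompletion F)ˣ (localUnits 𝔭) :=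
  QuotientGroup.map _ _ (ideleEval 𝔭) (by
    rintro _ ⟨u, hu, rfl⟩
    refine ⟨ideleEval 𝔭 u, ?_, by simp⟩
    exact (Subgroup.mem_iInf.mp hu) 𝔭)

/-- The valuation `ord_𝔭 : F_𝔭ˣ → ℤ`, normalized so that uniformizers have valuation `1`. -/
def ordHom (𝔭 : HeightOneSpectrum (𝓞 F)) :
    (𝔭.adicCompletion F)ˣ →* Multiplicative ℤ where
  toFun u := Multiplicative.ofAdd (-WithZero.log (Valued.v (u : 𝔭.adicCompletion F)))
  map_one' := by simp
  map_mul' a b := by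
    rw [Units.val_mul, map_mul, WithZero.log_mul (by simp) (by simp), neg_add, ofAdd_add]

/-- The valuation `ord_𝔭(S_𝔭)` of a local integral squareclass. -/
def localOrd (𝔭 : HeightOneSpectrum (𝓞 F)) :
    SqCl (𝔭.adicCompletion F)ˣ (localUnits 𝔭) →* Multiplicative ℤ :=
  QuotientGroup.lift _ (ordHom 𝔭) (by
    rintro _ ⟨u, hu, rfl⟩
    have h : Valued.v (u : 𝔭.adicCompletion F) = 1 := hu
    simp [ordHom, h])

/-- The valuation `ord_𝔭(S)` of a non-archimedean squareclass. -/
def ord (𝔭 : HeightOneSpectrum (𝓞 F)) (S : IdeleSqCl F) : ℤ :=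
  Multiplicative.toAdd (localOrd 𝔭 (component 𝔭 S))

/-- The associated (fractional) ideal `𝔍(S) = ∏_𝔭 𝔭 ^ ord_𝔭(S)`. -/
def assocIdeal (S : IdeleSqCl F) : FractionalIdeal (nonZeroDivisors (𝓞 F)) F :=
  ∏ᶠ 𝔭 : HeightOneSpectrum (𝓞 F),
    (𝔭.asIdeal : FractionalIdeal (nonZeroDivisors (𝓞 F)) F) ^ ord 𝔭 S

end Squareclass

/-! ### The Hessian determinant of a quadratic lattice -/

section Hessian

/-- The Hessian matrix `(∂²Q/∂xᵢ∂xⱼ)` of a quadratic form in the coordinates given by `b`: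
its entries are `Q(bᵢ + bⱼ) - Q(bᵢ) - Q(bⱼ)`, in particular `2 Q(bᵢ)` on the diagonal. -/
def hessianMatrix {R M ι : Type*} [CommRing R] [AddCommGroup M] [Module R M]
    (Q : QuadraticForm R M) (b : ι → M) : Matrix ι ι R :=
  Matrix.of fun i j => QuadraticMap.polar Q (b i) (b j)

lemma hessianMatrix_det_of_comb {R M ι : Type*} [CommRing R] [AddCommGroup M] [Module R M]
    [Fintype ι] [DecidableEq ι] (Q : QuadraticForm R M) (b b' : ι → M) (P : Matrix ι ι R)
    (h : ∀ j, b' j = ∑ i, P i j • b i) :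
    (hessianMatrix Q b').det = P.det ^ 2 * (hessianMatrix Q b).det := by
  have : hessianMatrix Q b' = P.transpose * hessianMatrix Q b * P := by
    ext i j
    simp only [hessianMatrix, Matrix.of_apply, Matrix.mul_apply, Matrix.transpose_apply]
    rw [← QuadraticMap.polarBilin_apply_apply, h i, h j]
    simp only [map_sum, map_smul, LinearMap.sum_apply, LinearMap.smul_apply, smul_eq_mul,
      QuadraticMap.polarBilin_apply_apply, Finset.sum_mul, Finset.mul_sum]
    refine Finset.sum_congr rfl fun k _ => Finset.sum_congr rfl fun l _ => by ring
  rw [this, Matrix.det_mul, Matrix.det_mul, Matrix.det_transpose]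
  ring

lemma hessianMatrix_det_reindex {R M ι κ : Type*} [CommRing R] [AddCommGroup M] [Module R M]
    [Fintype ι] [DecidableEq ι] [Fintype κ] [DecidableEq κ] (Q : QuadraticForm R M)
    (b : ι → M) (e : κ ≃ ι) :
    (hessianMatrix Q (b ∘ e)).det = (hessianMatrix Q b).det :=
  Matrix.det_submatrix_equiv_self e (hessianMatrix Q b)

/-- Two bases of a lattice have Hessian determinants that differ by the square of a unit. -/
lemma hessianMatrix_det_basis {O E M ι κ : Type*} [CommRing O] [Nontrivial O] [CommRing E]
    [Algebra O E] [AddCommGroup M] [Module O M] [Module E M] [IsScalarTower O E M]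
    [Fintype ι] [DecidableEq ι] [Fintype κ] [DecidableEq κ] (Q : QuadraticForm E M)
    (L : Submodule O M) (b : Basis ι O L) (b' : Basis κ O L) :
    ∃ u : Oˣ, (hessianMatrix Q fun i => (b' i : M)).det =
      (algebraMap O E u) ^ 2 * (hessianMatrix Q fun i => (b i : M)).det := by
  let e : κ ≃ ι := b'.indexEquiv b
  let c : Basis κ O L := b.reindex e.symm
  have hc : (hessianMatrix Q fun i => (c i : M)).det = (hessianMatrix Q fun i => (b i : M)).det := by
    rw [← hessianMatrix_det_reindex Q (fun i => (b i : M)) e]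
    congr 2
    ext i
    simp [c]
  have hu : IsUnit (c.toMatrix b').det := by
    have := c.invertibleToMatrix b'
    exact (Matrix.isUnit_iff_isUnit_det _).mp (isUnit_of_invertible _)
  refine ⟨hu.unit, ?_⟩
  rw [← hc, hessianMatrix_det_of_comb Q (fun i => (c i : M)) (fun i => (b' i : M))
    ((c.toMatrix b').map (algebraMap O E))]
  · congr 2
    exact ((algebraMap O E).map_det _).symm
  · intro j
    have h1 : (b' j : M) = ((∑ i, c.toMatrix b' i j • c i : L) : M) := by
      rw [c.sum_toMatrix_smul_self]
    rw [h1]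
    simp only [Submodule.coe_sum, Submodule.coe_smul, Matrix.map_apply, algebraMap_smul]

variable {F : Type*} [Field F] [NumberField F] {V : Type*} [AddCommGroup V] [Module F V]
  [Module (𝓞 F) V] [IsScalarTower (𝓞 F) F V]

/-- The localization `L_𝔭 = 𝒪_𝔭 · L` of a lattice `L ⊆ V`, inside `V_𝔭 = F_𝔭 ⊗_F V`. -/
def localLattice (L : Submodule (𝓞 F) V) (𝔭 : HeightOneSpectrum (𝓞 F)) :
    Submodule (𝔭.adicCompletionIntegers F) (𝔭.adicCompletion F ⊗[F] V) :=
  Submodule.span _ ((fun x : V => (1 : 𝔭.adicCompletion F) ⊗ₜ[F] x) '' (L : Set V))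

/-- The localization `Q_𝔭` of a quadratic form `Q` on `V`, a quadratic form on `V_𝔭`. -/
def localForm (Q : QuadraticForm F V) (𝔭 : HeightOneSpectrum (𝓞 F)) :
    QuadraticForm (𝔭.adicCompletion F) (𝔭.adicCompletion F ⊗[F] V) :=
  letI : Invertible (2 : F) := invertibleOfNonzero two_ne_zero
  Q.baseChange (𝔭.adicCompletion F)

lemma integral_smul_tmul (𝔭 : HeightOneSpectrum (𝓞 F)) (r : F) (hr : 𝔭.valuation F r ≤ 1)
    (x : V) : ∃ s : 𝔭.adicCompletionIntegers F,
      (1 : 𝔭.adicCompletion F) ⊗ₜ[F] (r • x) = s • ((1 : 𝔭.adicCompletion F) ⊗ₜ[F] x) := by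
  refine ⟨⟨(r : 𝔭.adicCompletion F), ?_⟩, ?_⟩
  · rw [HeightOneSpectrum.mem_adicCompletionIntegers,
      HeightOneSpectrum.valuedAdicCompletion_eq_valuation']
    exact hr
  · rw [TensorProduct.tmul_smul, TensorProduct.smul_tmul', TensorProduct.smul_tmul']
    congr 1
    rw [Algebra.smul_def]
    rfl

lemma valuation_algebraMap_le (𝔭 : HeightOneSpectrum (𝓞 F)) (r : 𝓞 F) :
    𝔭.valuation F (algebraMap (𝓞 F) F r) ≤ 1 :=
  𝔭.valuation_le_one r

lemma localLattice_le (L : Submodule (𝓞 F) V) (T : Set V) (hT : Submodule.span (𝓞 F) T = L)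
    (𝔭 : HeightOneSpectrum (𝓞 F))
    (N : Submodule (𝔭.adicCompletionIntegers F) (𝔭.adicCompletion F ⊗[F] V))
    (h : ∀ t ∈ T, (1 : 𝔭.adicCompletion F) ⊗ₜ[F] t ∈ N) : localLattice L 𝔭 ≤ N := by
  refine Submodule.span_le.mpr ?_
  rintro _ ⟨x, hx, rfl⟩
  have hx' : x ∈ Submodule.span (𝓞 F) T := by rw [hT]; exact hx
  show (1 : 𝔭.adicCompletion F) ⊗ₜ[F] x ∈ N
  clear hx
  induction hx' using Submodule.span_induction with
  | mem x hx => exact h x hx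
  | zero => simp
  | add x y hx hy h1 h2 =>
    rw [TensorProduct.tmul_add]
    exact N.add_mem h1 h2
  | smul r x hx h1 =>
    obtain ⟨s, hs⟩ := integral_smul_tmul 𝔭 (algebraMap (𝓞 F) F r) (valuation_algebraMap_le 𝔭 r) x
    rw [algebraMap_smul] at hs
    rw [hs]
    exact N.smul_mem _ h1

instance localLattice_isLattice (L : Submodule (𝓞 F) V) [Submodule.IsLattice F L]
    (𝔭 : HeightOneSpectrum (𝓞 F)) :
    Submodule.IsLattice (𝔭.adicCompletion F) (localLattice L 𝔭) where
  fg := by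
    obtain ⟨T, hT⟩ := Submodule.IsLattice.fg (A := F) (M := L)
    have : localLattice L 𝔭 = Submodule.span _
        ((fun x : V => (1 : 𝔭.adicCompletion F) ⊗ₜ[F] x) '' (T : Set V)) := by
      refine le_antisymm (localLattice_le L T hT 𝔭 _ fun t ht =>
        Submodule.subset_span ⟨t, ht, rfl⟩) (Submodule.span_mono (Set.image_mono ?_))
      rw [← hT]
      exact Submodule.subset_span
    rw [this]
    exact Submodule.fg_span (T.finite_toSet.image _)
  span_eq_top := by
    rw [eq_top_iff]
    rintro x -
    induction x using TensorProduct.induction_on with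
    | zero => simp
    | add x y hx hy => exact Submodule.add_mem _ hx hy
    | tmul a x =>
      have hx : x ∈ Submodule.span F (L : Set V) := by
        rw [Submodule.IsLattice.span_eq_top]
        trivial
      have h1 : a ⊗ₜ[F] x = a • ((1 : 𝔭.adicCompletion F) ⊗ₜ[F] x) := by
        rw [TensorProduct.smul_tmul', smul_eq_mul, mul_one]
      rw [h1]
      refine Submodule.smul_mem _ _ ?_
      induction hx using Submodule.span_induction with
      | mem x hx => exact Submodule.subset_span (Submodule.subset_span ⟨x, hx, rfl⟩)
      | zero => simp
      | add x y _ _ hx hy =>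
        rw [TensorProduct.tmul_add]
        exact Submodule.add_mem _ (hx (by
          rw [TensorProduct.smul_tmul', smul_eq_mul, mul_one])) (hy (by
          rw [TensorProduct.smul_tmul', smul_eq_mul, mul_one]))
      | smul r x _ hx =>
        have h2 : (1 : 𝔭.adicCompletion F) ⊗ₜ[F] (r • x) =
            (algebraMap F (𝔭.adicCompletion F) r) • ((1 : 𝔭.adicCompletion F) ⊗ₜ[F] x) := by
          rw [TensorProduct.tmul_smul, algebraMap_smul]
        rw [h2]
        exact Submodule.smul_mem _ _ (hx (by
          rw [TensorProduct.smul_tmul', smul_eq_mul, mul_one]))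

open scoped Classical in
/-- The determinant of the Hessian matrix of `Q_𝔭` in a chosen `𝒪_𝔭`-basis of `L_𝔭`. -/
def localHessianDet (Q : QuadraticForm F V) (L : Submodule (𝓞 F) V) [Submodule.IsLattice F L]
    (𝔭 : HeightOneSpectrum (𝓞 F)) : 𝔭.adicCompletion F :=
  (hessianMatrix (localForm Q 𝔭) fun i =>
    ((Free.chooseBasis (𝔭.adicCompletionIntegers F) (localLattice L 𝔭) i :
      localLattice L 𝔭) : 𝔭.adicCompletion F ⊗[F] V)).det

lemma localForm_polar (Q : QuadraticForm F V) (𝔭 : HeightOneSpectrum (𝓞 F)) (x y : V) :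
    QuadraticMap.polar (localForm Q 𝔭) (1 ⊗ₜ x) (1 ⊗ₜ y) =
      algebraMap F (𝔭.adicCompletion F) (QuadraticMap.polar Q x y) := by
  let _ : Invertible (2 : F) := invertibleOfNonzero two_ne_zero
  have h (z : V) : localForm Q 𝔭 ((1 : 𝔭.adicCompletion F) ⊗ₜ z) =
      algebraMap F (𝔭.adicCompletion F) (Q z) := by
    unfold localForm
    rw [QuadraticForm.baseChange_tmul, Algebra.smul_def]
    simp
  simp only [QuadraticMap.polar, ← TensorProduct.tmul_add, h, map_sub]

variable [FiniteDimensional F V]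

lemma hessian_finBasis_ne_zero (Q : QuadraticForm F V)
    (hQ : LinearMap.BilinForm.Nondegenerate Q.polarBilin) :
    (hessianMatrix Q (finBasis F V)).det ≠ 0 := by
  have := (LinearMap.BilinForm.nondegenerate_iff_det_ne_zero (finBasis F V)).mp hQ
  have h : hessianMatrix Q (finBasis F V) =
      LinearMap.BilinForm.toMatrix (finBasis F V) Q.polarBilin := by
    refine Matrix.ext fun i j => ?_
    rw [LinearMap.BilinForm.toMatrix_apply]
    rfl
  rwa [h]

lemma hessian_baseChange (Q : QuadraticForm F V) (𝔭 : HeightOneSpectrum (𝓞 F)) :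
    (hessianMatrix (localForm Q 𝔭)
      (fun i => (1 : 𝔭.adicCompletion F) ⊗ₜ[F] finBasis F V i)).det =
      algebraMap F (𝔭.adicCompletion F) (hessianMatrix Q (finBasis F V)).det := by
  rw [RingHom.map_det]
  congr 1
  exact Matrix.ext fun i j => localForm_polar Q 𝔭 _ _

lemma localHessianDet_ne_zero (Q : QuadraticForm F V)
    (hQ : LinearMap.BilinForm.Nondegenerate Q.polarBilin)
    (L : Submodule (𝓞 F) V) [Submodule.IsLattice F L] (𝔭 : HeightOneSpectrum (𝓞 F)) :
    localHessianDet Q L 𝔭 ≠ 0 := by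
  classical
  let b := Free.chooseBasis (𝔭.adicCompletionIntegers F) (localLattice L 𝔭)
  let b' := b.extendOfIsLattice (𝔭.adicCompletion F)
  let v := (finBasis F V).baseChange (𝔭.adicCompletion F)
  let e := v.indexEquiv b'
  intro h0
  have h1 : (hessianMatrix (localForm Q 𝔭) b').det = 0 := by
    rw [← h0]
    unfold localHessianDet
    congr 2
    ext i
    simp [b', b]
  have h2 : (hessianMatrix (localForm Q 𝔭) (b' ∘ e)).det = 0 := by
    rw [hessianMatrix_det_reindex, h1]
  have h3 := hessianMatrix_det_of_comb (localForm Q 𝔭) (b' ∘ e) v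
    ((b'.reindex e.symm).toMatrix v) (fun j => by
      have := (b'.reindex e.symm).sum_toMatrix_smul_self v j
      simpa using this.symm)
  rw [h2, mul_zero] at h3
  have h4 := hessian_baseChange Q 𝔭
  have h5 : (fun i => (1 : 𝔭.adicCompletion F) ⊗ₜ[F] finBasis F V i) = v := by
    ext i
    simp [v]
  rw [h5, h3] at h4
  exact hessian_finBasis_ne_zero Q hQ
    ((map_eq_zero (algebraMap F (𝔭.adicCompletion F))).mp h4.symm)

lemma eventually_integral (r : F) :
    ∀ᶠ 𝔭 : HeightOneSpectrum (𝓞 F) in Filter.cofinite, 𝔭.valuation F r ≤ 1 := by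
  rw [Filter.eventually_cofinite]
  refine (HeightOneSpectrum.Support.finite (𝓞 F) r).subset fun 𝔭 h => ?_
  exact not_le.mp h

lemma localHessianDet_eventually (Q : QuadraticForm F V)
    (hQ : LinearMap.BilinForm.Nondegenerate Q.polarBilin)
    (L : Submodule (𝓞 F) V) [Submodule.IsLattice F L] :
    ∀ᶠ 𝔭 in Filter.cofinite, Valued.v (localHessianDet Q L 𝔭) = 1 := by
  classical
  let v := finBasis F V
  obtain ⟨T, hT⟩ := Submodule.IsLattice.fg (A := F) (M := L)
  have hspan : Submodule.span F (T : Set V) = ⊤ := by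
    rw [← Submodule.IsLattice.span_eq_top (M := L) (A := F), ← hT]
    exact (Submodule.span_span_of_tower (𝓞 F) F (T : Set V)).symm
  have hv : ∀ i, ∃ a : V → F, v i = ∑ t ∈ T, a t • t := fun i => by
    have : v i ∈ Submodule.span F (T : Set V) := by rw [hspan]; trivial
    obtain ⟨a, -, ha⟩ := Submodule.mem_span_finset.mp this
    exact ⟨a, ha.symm⟩
  choose a ha using hv
  let d := (hessianMatrix Q v).det
  have hd : d ≠ 0 := hessian_finBasis_ne_zero Q hQ
  have e1 : ∀ᶠ 𝔭 : HeightOneSpectrum (𝓞 F) in Filter.cofinite,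
      ∀ i, ∀ t ∈ T, 𝔭.valuation F (a i t) ≤ 1 :=
    Filter.eventually_all.mpr fun i => (Filter.eventually_all_finset T).mpr fun t _ =>
      eventually_integral (a i t)
  have e2 : ∀ᶠ 𝔭 : HeightOneSpectrum (𝓞 F) in Filter.cofinite,
      ∀ i, ∀ t ∈ T, 𝔭.valuation F (v.repr t i) ≤ 1 :=
    Filter.eventually_all.mpr fun i => (Filter.eventually_all_finset T).mpr fun t _ =>
      eventually_integral (v.repr t i)
  filter_upwards [e1, e2, eventually_integral d, eventually_integral d⁻¹] with 𝔭 h1 h2 h3 h4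
  let w := fun i => (1 : 𝔭.adicCompletion F) ⊗ₜ[F] v i
  have hw : LinearIndependent (𝔭.adicCompletion F) w := by
    have := (v.baseChange (𝔭.adicCompletion F)).linearIndependent
    convert this using 1
    ext i
    simp [w]
  have hw' : LinearIndependent (𝔭.adicCompletionIntegers F) w :=
    (LinearIndependent.iff_fractionRing (R := 𝔭.adicCompletionIntegers F)
      (K := 𝔭.adicCompletion F)).mpr hw
  have hL : Submodule.span (𝔭.adicCompletionIntegers F) (Set.range w) = localLattice L 𝔭 := by
    refine le_antisymm (Submodule.span_le.mpr ?_) (localLattice_le L T hT 𝔭 _ fun t ht => ?_)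
    · rintro _ ⟨i, rfl⟩
      show (1 : 𝔭.adicCompletion F) ⊗ₜ[F] v i ∈ localLattice L 𝔭
      rw [ha i, TensorProduct.tmul_sum]
      refine Submodule.sum_mem _ fun t ht => ?_
      obtain ⟨s, hs⟩ := integral_smul_tmul 𝔭 (a i t) (h1 i t ht) t
      rw [hs]
      refine Submodule.smul_mem _ _ (Submodule.subset_span ⟨t, ?_, rfl⟩)
      rw [← hT]
      exact Submodule.subset_span ht
    · rw [← v.sum_repr t, TensorProduct.tmul_sum]
      refine Submodule.sum_mem _ fun i _ => ?_
      obtain ⟨s, hs⟩ := integral_smul_tmul 𝔭 (v.repr t i) (h2 i t ht) (v i)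
      rw [hs]
      exact Submodule.smul_mem _ _ (Submodule.subset_span ⟨i, rfl⟩)
  let b' := (Basis.span hw').map (LinearEquiv.ofEq _ _ hL)
  obtain ⟨u, hu⟩ := hessianMatrix_det_basis (localForm Q 𝔭) (localLattice L 𝔭) b'
    (Free.chooseBasis (𝔭.adicCompletionIntegers F) (localLattice L 𝔭))
  have hb' : (fun i => ((b' i : localLattice L 𝔭) : 𝔭.adicCompletion F ⊗[F] V)) = w := by
    ext i
    simp [b', Basis.span_apply]
  have h5 : Valued.v (algebraMap (𝔭.adicCompletionIntegers F) (𝔭.adicCompletion F) u) = 1 :=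
    HeightOneSpectrum.adicCompletionIntegers.isUnit_iff_valued_eq_one.mp u.isUnit
  have h6 : localHessianDet Q L 𝔭 =
      (algebraMap (𝔭.adicCompletionIntegers F) (𝔭.adicCompletion F) u) ^ 2 *
        (algebraMap F (𝔭.adicCompletion F) d) := by
    rw [← hessian_baseChange Q 𝔭]
    change _ = _ * (hessianMatrix (localForm Q 𝔭) w).det
    rw [← hb']
    exact hu
  have h7 : Valued.v (algebraMap F (𝔭.adicCompletion F) d) = 1 := by
    have : Valued.v (algebraMap F (𝔭.adicCompletion F) d) = 𝔭.valuation F d :=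
      HeightOneSpectrum.valuedAdicCompletion_eq_valuation' 𝔭 d
    rw [this]
    refine le_antisymm h3 ?_
    have h8 : 𝔭.valuation F d ≠ 0 := by simpa using hd
    rw [map_inv₀] at h4
    exact (inv_le_one₀ (zero_lt_iff.mpr h8)).mp h4
  rw [h6, map_mul, map_pow, h5, h7, one_pow, one_mul]

/-- The finite idele whose component at `𝔭` is `det (Hessian of Q_𝔭)` in a basis of `L_𝔭`. -/
def hessianIdele (Q : QuadraticForm F V)
    (hQ : LinearMap.BilinForm.Nondegenerate Q.polarBilin)
    (L : Submodule (𝓞 F) V) [Submodule.IsLattice F L] : (FiniteAdeleRing (𝓞 F) F)ˣ :=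
  IsUnit.unit (a := (⟨fun 𝔭 => localHessianDet Q L 𝔭,
      (localHessianDet_eventually Q hQ L).mono fun 𝔭 h =>
        (HeightOneSpectrum.mem_adicCompletionIntegers (𝓞 F) F 𝔭).mpr h.le⟩ :
      FiniteAdeleRing (𝓞 F) F))
    (FiniteAdeleRing.isUnit_iff.mpr
      ⟨localHessianDet_ne_zero Q hQ L, localHessianDet_eventually Q hQ L⟩)

/-- The Hessian determinant squareclass `det_H(L, Q) ∈ SqCl(𝔸_{F,f}ˣ, U_f)` of a non-degenerate
quadratic `𝒪_F`-lattice. -/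
def hessianDet (Q : QuadraticForm F V)
    (hQ : LinearMap.BilinForm.Nondegenerate Q.polarBilin)
    (L : Submodule (𝓞 F) V) [Submodule.IsLattice F L] : IdeleSqCl F :=
  QuotientGroup.mk (hessianIdele Q hQ L)

/-- The component of `det_H(L, Q)` at `𝔭` is the class of the Hessian determinant of `Q_𝔭` in
any `𝒪_𝔭`-basis of `L_𝔭`. -/
theorem component_hessianDet (Q : QuadraticForm F V)
    (hQ : LinearMap.BilinForm.Nondegenerate Q.polarBilin)
    (L : Submodule (𝓞 F) V) [Submodule.IsLattice F L] (𝔭 : HeightOneSpectrum (𝓞 F))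
    {ι : Type*} [Fintype ι] [DecidableEq ι]
    (b : Basis ι (𝔭.adicCompletionIntegers F) (localLattice L 𝔭)) (δ : (𝔭.adicCompletion F)ˣ)
    (hδ : (δ : 𝔭.adicCompletion F) = (hessianMatrix (localForm Q 𝔭) fun i =>
      ((b i : localLattice L 𝔭) : 𝔭.adicCompletion F ⊗[F] V)).det) :
    component 𝔭 (hessianDet Q hQ L) = QuotientGroup.mk δ := by
  classical
  change QuotientGroup.mk (ideleEval 𝔭 (hessianIdele Q hQ L)) = QuotientGroup.mk δ
  rw [QuotientGroup.eq]
  obtain ⟨u, hu⟩ := hessianMatrix_det_basis (localForm Q 𝔭) (localLattice L 𝔭)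
    (Free.chooseBasis (𝔭.adicCompletionIntegers F) (localLattice L 𝔭)) b
  refine ⟨Units.map (algebraMap (𝔭.adicCompletionIntegers F)
    (𝔭.adicCompletion F)).toMonoidHom u, ?_, ?_⟩
  · exact HeightOneSpectrum.adicCompletionIntegers.isUnit_iff_valued_eq_one.mp u.isUnit
  · rw [eq_inv_mul_iff_mul_eq]
    ext
    rw [hδ, hu, mul_comm]
    rfl

end Hessian

/-! ### The norm form of a quadratic extension -/

section NormForm

variable (F K : Type*) [Field F] [NumberField F] [Field K] [NumberField K] [Algebra F K]
  [Algebra.IsQuadraticExtension F K]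

variable {F K} in
lemma norm_add_eq (x y : K) :
    Algebra.norm F (x + y) = Algebra.norm F x + Algebra.norm F y +
      (Algebra.trace F K x * Algebra.trace F K y - Algebra.trace F K (x * y)) := by
  let b : Basis (Fin 2) F K := finBasisOfFinrankEq F K
    (Algebra.IsQuadraticExtension.finrank_eq_two F K)
  simp only [Algebra.norm_eq_matrix_det b, Algebra.trace_eq_matrix_trace b, map_add, map_mul,
    Matrix.det_fin_two, Matrix.trace_fin_two, Matrix.add_apply, Matrix.mul_apply,
    Fin.sum_univ_two]
  ring

/-- The relative norm of a quadratic extension `K/F`, as a quadratic form on the `F`-space `K`. -/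
def normForm : QuadraticForm F K where
  toFun x := Algebra.norm F x
  toFun_smul a x := by
    rw [Algebra.smul_def, map_mul, Algebra.norm_algebraMap,
      Algebra.IsQuadraticExtension.finrank_eq_two, sq, smul_eq_mul]
  exists_companion' :=
    ⟨(Algebra.trace F K).smulRight (Algebra.trace F K) - Algebra.traceForm F K,
      fun x y => by
        rw [norm_add_eq]
        simp⟩

lemma normForm_nondegenerate :
    LinearMap.BilinForm.Nondegenerate (normForm F K).polarBilin := by
  have h : ∀ x : K, QuadraticMap.polar (normForm F K) x x = 0 → x = 0 := fun x hx => by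
    rw [QuadraticMap.polar_self] at hx
    have h2 : (2 : F) * Algebra.norm F x = 0 := by
      rw [two_mul, ← two_nsmul]
      exact hx
    have : Algebra.norm F x = 0 := (mul_eq_zero.mp h2).resolve_left two_ne_zero
    exact Algebra.norm_eq_zero_iff.mp this
  exact ⟨fun x hx => h x (hx x), fun x hx => h x (hx x)⟩

/-- The ring of integers `𝒪_K`, as an `𝒪_F`-lattice in the `F`-space `K`. -/
def ringLattice (F K : Type*) [Field F] [Field K] [Algebra F K] : Submodule (𝓞 F) K :=
  LinearMap.range (IsScalarTower.toAlgHom (𝓞 F) (𝓞 K) K).toLinearMap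

instance ringLattice_isLattice : Submodule.IsLattice F (ringLattice F K) where
  fg := by
    rw [← Module.Finite.iff_fg]
    exact Module.Finite.range _
  span_eq_top := by
    rw [eq_top_iff]
    rintro x -
    obtain ⟨⟨y, d⟩, h⟩ := IsLocalization.surj
      (Algebra.algebraMapSubmonoid (𝓞 K) (nonZeroDivisors ℤ)) x
    obtain ⟨m, hm, hd⟩ := d.2
    have hm0 : (m : F) ≠ 0 := Int.cast_ne_zero.mpr (nonZeroDivisors.ne_zero hm)
    have h2 : x = (m : F)⁻¹ • (y : K) := by
      rw [eq_inv_smul_iff₀ hm0, Algebra.smul_def]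
      have h3 : algebraMap (𝓞 K) K d = (m : K) := by rw [← hd]; simp
      have h4 : x * algebraMap (𝓞 K) K d = algebraMap (𝓞 K) K y := h
      rw [h3] at h4
      rw [map_intCast, mul_comm]
      exact h4
    rw [h2]
    exact Submodule.smul_mem _ _ (Submodule.subset_span ⟨y, rfl⟩)

/-- The squareclass `S = det_H(𝒪_K, Norm_{K/F})`. -/
def detH : IdeleSqCl F := hessianDet (normForm F K) (normForm_nondegenerate F K) (ringLattice F K)

end NormForm

/-! ### The quadratic Hecke character and its `L`-function -/

section Hecke

variable (F K : Type*) [Field F] [NumberField F] [Field K] [NumberField K] [Algebra F K]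

/-- The rational prime `p` splits completely in `F`. -/
def SplitsCompletely (p : ℕ) (F : Type*) [Field F] [NumberField F] : Prop :=
  ∀ P ∈ (Ideal.span {(p : ℤ)}).primesOver (𝓞 F), P.ramificationIdx ℤ = 1 ∧ P.inertiaDeg ℤ = 1

variable {F}

/-- The prime `𝔭` of `F` is unramified in `K`. -/
def IsUnramifiedIn (𝔭 : HeightOneSpectrum (𝓞 F)) : Prop :=
  ∀ P ∈ 𝔭.asIdeal.primesOver (𝓞 K), P.ramificationIdx (𝓞 F) = 1

lemma exists_primeOver (𝔭 : HeightOneSpectrum (𝓞 F)) :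
    ∃ P : Ideal (𝓞 K), P ∈ 𝔭.asIdeal.primesOver (𝓞 K) :=
  Set.Nonempty.some_mem (Set.nonempty_coe_sort.mp inferInstance) |> fun h => ⟨_, h⟩

/-- A prime of `K` above `𝔭`. -/
def primeOver (𝔭 : HeightOneSpectrum (𝓞 F)) : Ideal (𝓞 K) := (exists_primeOver K 𝔭).choose

instance primeOver_isPrime (𝔭 : HeightOneSpectrum (𝓞 F)) : (primeOver K 𝔭).IsPrime :=
  (exists_primeOver K 𝔭).choose_spec.1

instance primeOver_finite (𝔭 : HeightOneSpectrum (𝓞 F)) : Finite (𝓞 K ⧸ primeOver K 𝔭) :=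
  Ideal.finiteQuotientOfFreeOfNeBot _
    (Ideal.ne_bot_of_mem_primesOver 𝔭.ne_bot (exists_primeOver K 𝔭).choose_spec)

/-- The Artin symbol `(K/F, 𝔭)`: an arithmetic Frobenius element at a prime of `K` above `𝔭`. For
abelian `K/F` and `𝔭` unramified in `K` it does not depend on any choice. -/
def artinSymbol [IsGalois F K] (𝔭 : HeightOneSpectrum (𝓞 F)) : Gal(K/F) :=
  arithFrobAt (𝓞 F) Gal(K/F) (primeOver K 𝔭)

open scoped Classical in
/-- The Hecke character `χ_{K/F}` that class field theory attaches to a quadratic extension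
`K/F`, as a function on primes: the Artin symbol followed by the isomorphism
`Gal(K/F) ≅ {1, -1}`, and `0` at the primes dividing the conductor (those ramified in `K`). -/
def heckeChar [Algebra.IsQuadraticExtension F K] (𝔭 : HeightOneSpectrum (𝓞 F)) : ℂ :=
  if IsUnramifiedIn K 𝔭 then (if artinSymbol K 𝔭 = 1 then 1 else -1) else 0

/-- The Euler factor `(1 - χ_{K/F}(𝔭) N(𝔭)^{-s})⁻¹`. -/
def eulerFactor [Algebra.IsQuadraticExtension F K] (s : ℂ) (𝔭 : HeightOneSpectrum (𝓞 F)) : ℂ :=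
  (1 - heckeChar K 𝔭 * (Ideal.absNorm 𝔭.asIdeal : ℂ) ^ (-s))⁻¹

variable (F)

/-- The Hecke `L`-function `L_F(s, χ_{K/F})`, by its Euler product in `Re s > 1`. -/
def heckeL [Algebra.IsQuadraticExtension F K] (s : ℂ) : ℂ :=
  ∏' 𝔭 : HeightOneSpectrum (𝓞 F), eulerFactor K s 𝔭

/-- The value `L_F(1, χ_{K/F})`, that is, the limit of `L_F(s, χ_{K/F})` as `s → 1⁺` (hence also
the value at `1` of the analytic continuation). -/
def heckeLOne [Algebra.IsQuadraticExtension F K] : ℂ :=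
  Filter.limUnder (nhdsWithin (1 : ℝ) (Set.Ioi 1)) fun s : ℝ => heckeL F K (s : ℂ)

end Hecke

/-! ### Unit index and Kronecker symbol -/

section Index

/-- The index `Q_{K/F} = [𝒪_Kˣ : μ_K 𝒪_Fˣ]`. -/
def unitIndex (F K : Type*) [Field F] [Field K] [Algebra F K] : ℕ :=
  (Units.torsion K ⊔ (Units.map (algebraMap (𝓞 F) (𝓞 K)).toMonoidHom).range).index

/-- The Kronecker symbol `(D/p)` at a prime `p`. -/
def kroneckerPrime (D : ℤ) (p : ℕ) : ℤ :=
  if p = 2 then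
    (if D % 2 = 0 then 0 else if D % 8 = 1 ∨ D % 8 = 7 then 1 else -1)
  else jacobiSym D p

/-- The Kronecker symbol `(D/n)` for `n ≥ 1`. -/
def kronecker (D : ℤ) (n : ℕ) : ℤ := (n.primeFactorsList.map (kroneckerPrime D)).prod

instance discr_neZero (K : Type*) [Field K] [NumberField K] : NeZero (discr K).natAbs :=
  ⟨Int.natAbs_ne_zero.mpr (discr_ne_zero K)⟩

end Index

end

end CMClassNumber

open CMClassNumber NumberField Filter Topology

/-! The formula is the quotient of the analytic class number formulas of $K$ and $F$. Each residue
at $s=1$ has the form $2^{r_1}(2\pi)^{r_2}hR/(w\sqrt{|\Delta|})$, and three comparisons turn the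
quotient into the stated formula.

L-value: in a quadratic extension $efg=2$, and the Frobenius at $\mathfrak p$ decides between split
and inert. Hence the Euler factors of $\zeta_K$ above $\mathfrak p$ multiply to the factor of
$\zeta_F$ at $\mathfrak p$ times that of $L_F(s,\chi_{K/F})$. So
$L_F(s,\chi_{K/F})=\zeta_K(s)/\zeta_F(s)$ for $\mathrm{Re}\,s>1$, and $L_F(1,\chi_{K/F})$ is the
quotient of the residues (`decomposition`, `hasProd_eulerFactor`, `heckeLOne_eq`).

Regulators: $R_K/R_F=2^{n-1}/Q_{K/F}$ with $n=[F:\mathbb Q]$ (`regulator_mul_unitIndex`).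

Discriminants: locally at $\mathfrak p$, $\mathcal O_K$ has a basis $1,\omega$, in which the Hessian
determinant of the norm is $4N(\omega)-T(\omega)^2$. This is the norm of
$2\omega-T(\omega)=f'(\omega)$, for $f$ the minimal polynomial of $\omega$, and $f'(\omega)$
generates the different locally. So $\mathfrak I(S)$ is the relative discriminant and
$|\Delta_K|=N(\mathfrak I(S))\Delta_F^2$ (`exists_local_generator`, `assocIdeal_detH`,
`absNorm_assocIdeal_detH`).

Over $\mathbb Q$, write $\mathcal O_K=\mathbb Z[\omega]$. Primes of norm $p$ correspond to roots
modulo $p$ of the polynomial of $\omega$, whose discriminant is $\Delta_K$, so the Hecke character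
at $p$ is the Kronecker symbol (`heckeChar_eq_kroneckerPrime`). Quadratic reciprocity makes that
symbol a Dirichlet character (`exists_dirichletCharacter_eq_kronecker`). The two $L$-functions agree
for $s>1$, hence at $1$ by continuity (`LFunction_one_eq`). -/

namespace CMClassNumber

open Filter

/-! ### The Euler product of the Dedekind zeta function -/

section DedekindZeta

variable (K : Type*) [Field K] [NumberField K]

lemma tendsto_sum_card_ideals_div :
    Tendsto (fun n : ℕ => (∑ k ∈ Finset.Icc 1 n,
      (Nat.card {I : Ideal (𝓞 K) // Ideal.absNorm I = k} : ℝ)) / n) atTop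
      (𝓝 (dedekindZeta_residue K)) := by
  refine ((Ideal.tendsto_norm_le_div_atTop₀ K).comp tendsto_natCast_atTop_atTop).congr fun n ↦ ?_
  simp only [Function.comp_apply, Nat.cast_le, ← Nat.cast_sum]
  congr
  rw [← add_left_inj 1, ← Ideal.card_norm_le_eq_card_norm_le_add_one,
    show Finset.Icc 1 n = Finset.Ioc 0 n from Finset.Icc_succ_left_eq_Ioc _ _,
    show 1 = Nat.card {I : Ideal (𝓞 K) // Ideal.absNorm I = 0} by simp [Ideal.absNorm_eq_zero_iff],
    Finset.sum_Ioc_add_eq_sum_Icc (n.zero_le),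
    ← Finset.card_preimage_eq_sum_card_image_eq (fun k _ ↦ Ideal.finite_setOfPred_absNorm_eq k)]
  simp [Set.coe_eq_subtype]

/-- The number of ideals of norm at most $n$ grows linearly, so the Dirichlet series with these
nonnegative coefficients converges absolutely for $\mathrm{Re}\,s>1$. -/
lemma lseriesSummable_card_ideals {s : ℂ} (hs : 1 < s.re) :
    LSeriesSummable (fun n ↦ (Nat.card {I : Ideal (𝓞 K) // Ideal.absNorm I = n} : ℂ)) s := by
  have := LSeriesSummable_of_sum_norm_bigO_and_nonneg
    (f := fun n ↦ (Nat.card {I : Ideal (𝓞 K) // Ideal.absNorm I = n} : ℝ)) (r := 1) (s := s) ?_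
    (fun n => Nat.cast_nonneg _) zero_le_one hs
  · simpa using this
  · have h := (tendsto_sum_card_ideals_div K).isBigO_one ℝ
    have h2 := h.mul (Asymptotics.isBigO_refl (fun n : ℕ => (n : ℝ)) atTop)
    refine (h2.congr' ?_ ?_)
    · filter_upwards [eventually_ne_atTop 0] with n hn
      field_simp
    · filter_upwards with n
      simp

variable {K}

lemma absNorm_cpow_mul (s : ℂ) (I J : Ideal (𝓞 K)) :
    (Ideal.absNorm (I * J) : ℂ) ^ (-s) =
      (Ideal.absNorm I : ℂ) ^ (-s) * (Ideal.absNorm J : ℂ) ^ (-s) := by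
  rw [map_mul, Nat.cast_mul, Complex.natCast_mul_natCast_cpow]

instance finite_absNorm_fiber (n : ℕ) : Finite {I : Ideal (𝓞 K) // Ideal.absNorm I = n} :=
  (Ideal.finite_setOfPred_absNorm_eq n).to_subtype

lemma term_card_ideals {s : ℂ} (hs : 1 < s.re) (n : ℕ) :
    ∑' I : {I : Ideal (𝓞 K) // Ideal.absNorm I = n}, (Ideal.absNorm I.1 : ℂ) ^ (-s) =
    LSeries.term (fun n ↦ (Nat.card {I : Ideal (𝓞 K) // Ideal.absNorm I = n} : ℂ)) s n := by
  have h1 : ∀ I : {I : Ideal (𝓞 K) // Ideal.absNorm I = n},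
    (Ideal.absNorm I.1 : ℂ) ^ (-s) = (n : ℂ) ^ (-s) := fun I => by rw [I.2]
  have := Fintype.ofFinite {I : Ideal (𝓞 K) // Ideal.absNorm I = n}
  rw [tsum_congr h1, tsum_fintype, Finset.sum_const, Finset.card_univ, nsmul_eq_mul,
    LSeries.term_def]
  have hs0 : s ≠ 0 := by rintro rfl; simp at hs; linarith
  split_ifs with h
  · subst h
    simp [hs0]
  · rw [Nat.card_eq_fintype_card, Complex.cpow_neg, div_eq_mul_inv]

lemma summable_norm_absNorm_cpow {s : ℂ} (hs : 1 < s.re) :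
    Summable fun I : Ideal (𝓞 K) => ‖(Ideal.absNorm I : ℂ) ^ (-s)‖ := by
  rw [← (Equiv.sigmaFiberEquiv (fun I : Ideal (𝓞 K) => Ideal.absNorm I)).summable_iff]
  rw [summable_sigma_of_nonneg fun _ => by simp only [Function.comp_apply]; exact norm_nonneg _]
  refine ⟨fun n => Summable.of_finite, ?_⟩
  have h := (lseriesSummable_card_ideals K hs).norm
  refine h.congr fun n => ?_
  rw [← term_card_ideals hs]
  have := Fintype.ofFinite {I : Ideal (𝓞 K) // Ideal.absNorm I = n}
  have h1 : ∀ I : {I : Ideal (𝓞 K) // Ideal.absNorm I = n},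
    (Ideal.absNorm I.1 : ℂ) ^ (-s) = (n : ℂ) ^ (-s) := fun I => by rw [I.2]
  have h2 : ∀ I : {I : Ideal (𝓞 K) // Ideal.absNorm I = n},
    ((fun I : Ideal (𝓞 K) => ‖(Ideal.absNorm I : ℂ) ^ (-s)‖) ∘
      (Equiv.sigmaFiberEquiv (fun I : Ideal (𝓞 K) => Ideal.absNorm I))) ⟨n, I⟩ =
      ‖(n : ℂ) ^ (-s)‖ := fun I => by simp [Equiv.sigmaFiberEquiv, I.2]
  rw [tsum_congr h1, tsum_congr h2, tsum_fintype, tsum_fintype]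
  simp

lemma hasSum_absNorm_cpow {s : ℂ} (hs : 1 < s.re) :
    HasSum (fun I : Ideal (𝓞 K) => (Ideal.absNorm I : ℂ) ^ (-s)) (dedekindZeta K s) := by
  have h := (summable_norm_absNorm_cpow (K := K) hs).of_norm
  have h2 := (Equiv.hasSum_iff (Equiv.sigmaFiberEquiv
    (fun I : Ideal (𝓞 K) => Ideal.absNorm I))).mpr h.hasSum
  have h3 := h2.sigma (g := LSeries.term
    (fun n ↦ (Nat.card {I : Ideal (𝓞 K) // Ideal.absNorm I = n} : ℂ)) s) fun n => by
      rw [← term_card_ideals hs]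
      exact (Summable.of_finite (f := fun I : {I : Ideal (𝓞 K) // Ideal.absNorm I = n} =>
        (Ideal.absNorm I.1 : ℂ) ^ (-s))).hasSum
  rw [dedekindZeta, LSeries, h3.tsum_eq]
  exact h.hasSum

open scoped Classical in
/-- The part of the Dedekind zeta series that runs over the ideals prime to a finite set. -/
lemma hasSum_coprime {s : ℂ} (hs : 1 < s.re) (T : Finset (HeightOneSpectrum (𝓞 K))) :
    HasSum (fun I : Ideal (𝓞 K) =>
      if ∀ P ∈ T, ¬ P.asIdeal ∣ I then (Ideal.absNorm I : ℂ) ^ (-s) else 0)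
      (dedekindZeta K s * ∏ P ∈ T, (1 - (Ideal.absNorm P.asIdeal : ℂ) ^ (-s))) := by
  induction T using Finset.induction_on with
  | empty => simpa using hasSum_absNorm_cpow hs
  | insert P T hP ih =>
    set f : Ideal (𝓞 K) → ℂ := fun I =>
      if ∀ P ∈ T, ¬ P.asIdeal ∣ I then (Ideal.absNorm I : ℂ) ^ (-s) else 0 with hf
    have hinj : Function.Injective fun I : Ideal (𝓞 K) => P.asIdeal * I :=
      fun I J h => mul_left_cancel₀ P.ne_bot h
    -- Multiplication by `P` is injective with image the multiples of `P`, and does not affect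
    -- divisibility by the primes of `T`, as `P ∉ T`. So the terms divisible by `P` sum to
    -- $N(P)^{-s}$ times the whole; subtracting them produces the new factor.
    have h1 : HasSum (fun I => if P.asIdeal ∣ I then f I else 0)
        ((Ideal.absNorm P.asIdeal : ℂ) ^ (-s) *
          (dedekindZeta K s * ∏ P ∈ T, (1 - (Ideal.absNorm P.asIdeal : ℂ) ^ (-s)))) := by
      rw [← hinj.hasSum_iff]
      · refine (ih.mul_left _).congr_fun ?_
        intro I
        simp only [Function.comp_apply, dvd_mul_right, if_true, hf]
        have : (∀ Q ∈ T, ¬ Q.asIdeal ∣ P.asIdeal * I) ↔ ∀ Q ∈ T, ¬ Q.asIdeal ∣ I := by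
          refine forall₂_congr fun Q hQ => not_congr ⟨fun h => ?_, fun h => h.mul_left _⟩
          refine (Q.prime.dvd_or_dvd h).resolve_left fun h' => hP ?_
          have : P = Q := HeightOneSpectrum.ext
            (P.isMaximal.eq_of_le Q.isPrime.ne_top (Ideal.dvd_iff_le.mp h'))
          rwa [this]
        simp only [this]
        split_ifs
        · rw [absNorm_cpow_mul]
        · simp
      · intro I hI
        rw [if_neg]
        rintro ⟨J, rfl⟩
        exact hI ⟨J, rfl⟩
    have h2 := ih.sub h1
    rw [Finset.prod_insert hP]
    convert! h2 using 1
    · ext I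
      simp only [hf, Finset.forall_mem_insert]
      by_cases h : P.asIdeal ∣ I <;> simp [h]
    · ring

lemma exists_prime_dvd_of_ne_top {I : Ideal (𝓞 K)} (hI : I ≠ ⊤) (h0 : I ≠ ⊥) :
    ∃ P : HeightOneSpectrum (𝓞 K), P.asIdeal ∣ I := by
  obtain ⟨M, hM, h⟩ := Ideal.exists_le_maximal I hI
  exact ⟨⟨M, hM.isPrime, fun hb => h0 (by rw [hb] at h; exact le_bot_iff.mp h)⟩,
    Ideal.dvd_iff_le.mpr h⟩

/-- Sieving by ever larger finite sets of primes leaves only the unit ideal, so by dominated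
convergence $\zeta_K(s)$ times the partial products tends to $1$. This gives both the non-vanishing
and the product. -/
lemma hasProd_one_sub {s : ℂ} (hs : 1 < s.re) :
    dedekindZeta K s ≠ 0 ∧
    HasProd (fun P : HeightOneSpectrum (𝓞 K) => 1 - (Ideal.absNorm P.asIdeal : ℂ) ^ (-s))
      (dedekindZeta K s)⁻¹ := by
  classical
  have hs0 : s ≠ 0 := by rintro rfl; simp at hs; linarith
  have key : Tendsto (fun T : Finset (HeightOneSpectrum (𝓞 K)) =>
      dedekindZeta K s * ∏ P ∈ T, (1 - (Ideal.absNorm P.asIdeal : ℂ) ^ (-s))) atTop (𝓝 1) := by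
    refine Tendsto.congr (fun T => (hasSum_coprime (K := K) hs T).tsum_eq) ?_
    rw [show 𝓝 (1 : ℂ) = 𝓝 (∑' I : Ideal (𝓞 K), if I = ⊤ then (1 : ℂ) else 0) by
      rw [tsum_ite_eq]]
    refine tendsto_tsum_of_dominated_convergence (summable_norm_absNorm_cpow (K := K) hs) ?_ ?_
    · intro I
      refine tendsto_const_nhds.congr' ?_
      by_cases hI : I = ⊤
      · subst hI
        refine Eventually.of_forall fun T => ?_
        have h (P) (_ : P ∈ T) : ¬ P.asIdeal ∣ (⊤ : Ideal (𝓞 K)) := by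
          intro h
          exact P.isPrime.ne_top (top_le_iff.mp (Ideal.dvd_iff_le.mp h))
        simp [if_pos h]
      · by_cases h0 : I = ⊥
        · subst h0
          refine Eventually.of_forall fun T => ?_
          -- The zero ideal survives no nonempty sieve, and its term is $0^{-s}=0$ in any case
          -- because $s\neq0$.
          simp [hs0, hI]
        · obtain ⟨P, hP⟩ := exists_prime_dvd_of_ne_top hI h0
          filter_upwards [eventually_ge_atTop {P}] with T hT
          rw [if_neg hI, if_neg]
          push Not
          exact ⟨P, hT (Finset.mem_singleton_self P), hP⟩
    · refine Eventually.of_forall fun T I => ?_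
      split_ifs <;> simp
  have hne : dedekindZeta K s ≠ 0 := by
    intro h
    simp only [h, zero_mul] at key
    exact zero_ne_one (tendsto_nhds_unique tendsto_const_nhds key)
  refine ⟨hne, ?_⟩
  have := key.const_mul (dedekindZeta K s)⁻¹
  simpa [hne, HasProd] using this

end DedekindZeta

end CMClassNumber

namespace CMClassNumber

open Filter
open scoped Pointwise

/-! ### Splitting of primes in a quadratic extension and $L_F(s,\chi)=\zeta_K/\zeta_F$ -/

section Decomposition

variable {F K : Type*} [Field F] [NumberField F] [Field K] [NumberField K] [Algebra F K]
  [Algebra.IsQuadraticExtension F K]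

lemma one_lt_absNorm (𝔭 : HeightOneSpectrum (𝓞 F)) : 1 < Ideal.absNorm 𝔭.asIdeal := by
  have h0 : Ideal.absNorm 𝔭.asIdeal ≠ 0 := fun h => 𝔭.ne_bot (Ideal.absNorm_eq_zero_iff.mp h)
  have h1 : Ideal.absNorm 𝔭.asIdeal ≠ 1 := fun h =>
    𝔭.isPrime.ne_top (Ideal.absNorm_eq_one_iff.mp h)
  omega

/-- The polynomial $X^q-X$ has at most $q$ roots. This bounds the residue field of a prime whose
Frobenius is trivial. -/
lemma card_le_of_forall_pow_eq {k : Type*} [Field k] [Finite k] {q : ℕ}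
    (hq : 1 < q) (h : ∀ x : k, x ^ q = x) : Nat.card k ≤ q := by
  have := Fintype.ofFinite k
  classical
  have h1 := Polynomial.card_le_degree_of_subset_roots 
    (p := (Polynomial.X ^ q - Polynomial.X : Polynomial k)) (Z := Finset.univ) (by
      intro x _
      rw [Polynomial.mem_roots (FiniteField.X_pow_card_sub_X_ne_zero k hq)]
      simp [h x])
  rw [FiniteField.X_pow_card_sub_X_natDegree_eq k hq] at h1
  rwa [Nat.card_eq_fintype_card, ← Finset.card_univ]

lemma card_gal : Nat.card Gal(K/F) = 2 := by
  rw [IsGalois.card_aut_eq_finrank, Algebra.IsQuadraticExtension.finrank_eq_two]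

variable (K) in
/-- The decomposition of a prime in a quadratic extension is governed by `heckeChar`. -/
lemma decomposition (𝔭 : HeightOneSpectrum (𝓞 F)) :
    ∃ f : ℕ, (∀ P ∈ 𝔭.asIdeal.primesOver (𝓞 K),
        Ideal.absNorm P = Ideal.absNorm 𝔭.asIdeal ^ f) ∧
      ((heckeChar K 𝔭 = 1 ∧ f = 1 ∧ (𝔭.asIdeal.primesOver (𝓞 K)).ncard = 2) ∨
       (heckeChar K 𝔭 = -1 ∧ f = 2 ∧ (𝔭.asIdeal.primesOver (𝓞 K)).ncard = 1) ∨
       (heckeChar K 𝔭 = 0 ∧ f = 1 ∧ (𝔭.asIdeal.primesOver (𝓞 K)).ncard = 1)) := by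
  have hfund := Ideal.ncard_primesOver_mul_ramificationIdxIn_mul_inertiaDegIn 𝔭.asIdeal (𝓞 K)
    Gal(K/F)
  rw [card_gal] at hfund
  set e := 𝔭.asIdeal.ramificationIdxIn (𝓞 K)
  set f := 𝔭.asIdeal.inertiaDegIn (𝓞 K)
  set g := (𝔭.asIdeal.primesOver (𝓞 K)).ncard
  have hnorm : ∀ P ∈ 𝔭.asIdeal.primesOver (𝓞 K),
      Ideal.absNorm P = Ideal.absNorm 𝔭.asIdeal ^ f := by
    rintro P ⟨hP, hP'⟩
    rw [← Ideal.absNorm_pow_inertiaDeg 𝔭.asIdeal P,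
      ← Ideal.inertiaDegIn_eq_inertiaDeg 𝔭.asIdeal P Gal(K/F)]
  have hram : ∀ P ∈ 𝔭.asIdeal.primesOver (𝓞 K), P.ramificationIdx (𝓞 F) = e := by
    rintro P ⟨hP, hP'⟩
    rw [← Ideal.ramificationIdxIn_eq_ramificationIdx 𝔭.asIdeal P Gal(K/F)]
  obtain ⟨hP0, hP0'⟩ : primeOver K 𝔭 ∈ 𝔭.asIdeal.primesOver (𝓞 K) :=
    (exists_primeOver K 𝔭).choose_spec
  have hunr : IsUnramifiedIn K 𝔭 ↔ e = 1 :=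
    ⟨fun h => by rw [← hram _ ⟨hP0, hP0'⟩]; exact h _ ⟨hP0, hP0'⟩,
      fun h P hP => (hram P hP).trans h⟩
  refine ⟨f, hnorm, ?_⟩
  by_cases he : e = 1
  swap
  · refine Or.inr (Or.inr ⟨by rw [heckeChar, if_neg (hunr.not.mpr he)], ?_⟩)
    have h2 : e ∣ 2 := ⟨g * f, by rw [← hfund]; ring⟩
    have h3 : e = 2 := ((Nat.dvd_prime Nat.prime_two).mp h2).resolve_left he
    rw [h3] at hfund
    have h4 : g * f = 1 := by linarith
    exact ⟨Nat.eq_one_of_mul_eq_one_left h4, Nat.eq_one_of_mul_eq_one_right h4⟩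
  rw [he, one_mul] at hfund
  have hfrob : IsArithFrobAt (𝓞 F) (artinSymbol K 𝔭) (primeOver K 𝔭) :=
    IsArithFrobAt.arithFrobAt (𝓞 F) Gal(K/F) (primeOver K 𝔭)
  have hq : Nat.card (𝓞 F ⧸ (primeOver K 𝔭).under (𝓞 F)) = Ideal.absNorm 𝔭.asIdeal := by
    rw [← hP0'.over]
    rfl
  by_cases hσ : artinSymbol K 𝔭 = 1
  · refine Or.inl ⟨by rw [heckeChar, if_pos (hunr.mpr he), if_pos hσ], ?_⟩
    -- A trivial Frobenius means $x^q=x$ on the residue field, with $q=N(\mathfrak p)$; this forces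
    -- $f=1$.
    have h1 : Nat.card (𝓞 K ⧸ primeOver K 𝔭) ≤ Ideal.absNorm 𝔭.asIdeal := by
      have : (primeOver K 𝔭).IsMaximal := hP0.isMaximal
        (Ideal.ne_bot_of_mem_primesOver 𝔭.ne_bot ⟨hP0, hP0'⟩)
      let _ := Ideal.Quotient.field (primeOver K 𝔭)
      refine card_le_of_forall_pow_eq (one_lt_absNorm 𝔭) fun x => ?_
      obtain ⟨x, rfl⟩ := Ideal.Quotient.mk_surjective x
      have h := hfrob.mk_apply x
      rw [hq, hσ] at h
      simpa using h.symm
    have h2 : Ideal.absNorm 𝔭.asIdeal ^ f ≤ Ideal.absNorm 𝔭.asIdeal ^ 1 := by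
      rw [← hnorm _ ⟨hP0, hP0'⟩, pow_one]
      exact h1
    have h3 : f ≤ 1 := (Nat.pow_le_pow_iff_right (one_lt_absNorm 𝔭)).mp h2
    have h4 : f ≠ 0 := by rintro h; simp [h] at hfund
    have h5 : f = 1 := by omega
    rw [h5] at hfund
    exact ⟨h5, by linarith⟩
  · refine Or.inr (Or.inl ⟨by rw [heckeChar, if_pos (hunr.mpr he), if_neg hσ], ?_⟩)
    -- The Frobenius fixes the chosen prime. Being nontrivial in a group of order $2$, it forces the
    -- decomposition group to be everything, and transitivity of the Galois action leaves a single
    -- prime.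
    have hst : MulAction.stabilizer Gal(K/F) (primeOver K 𝔭) = ⊤ := by
      have : Fact (Nat.card Gal(K/F)).Prime := ⟨by rw [card_gal]; exact Nat.prime_two⟩
      refine (Subgroup.eq_bot_or_eq_top_of_prime_card _).resolve_left fun h => hσ ?_
      have := hfrob.mem_stabilizer
      rwa [h, Subgroup.mem_bot] at this
    have hg : g = 1 := by
      rw [Set.ncard_eq_one]
      refine ⟨primeOver K 𝔭, ?_⟩
      rw [Set.eq_singleton_iff_unique_mem]
      refine ⟨⟨hP0, hP0'⟩, ?_⟩
      rintro Q ⟨hQ, hQ'⟩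
      obtain ⟨τ, hτ⟩ := Ideal.exists_smul_eq_of_isGaloisGroup 𝔭.asIdeal (primeOver K 𝔭) Q Gal(K/F)
      rw [← hτ]
      have : τ ∈ MulAction.stabilizer Gal(K/F) (primeOver K 𝔭) := by rw [hst]; trivial
      exact this
    rw [hg] at hfund
    exact ⟨by linarith, hg⟩

/-- The primes of `K` above `𝔭`, as fibres of the restriction of primes. -/
def fiberEquivPrimesOver (𝔭 : HeightOneSpectrum (𝓞 F)) :
    {P : HeightOneSpectrum (𝓞 K) // P.under (𝓞 F) = 𝔭} ≃ 𝔭.asIdeal.primesOver (𝓞 K) where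
  toFun P := ⟨P.1.asIdeal, P.1.isPrime, ⟨(congrArg HeightOneSpectrum.asIdeal P.2).symm⟩⟩
  invFun P := ⟨⟨P.1, P.2.1, Ideal.ne_bot_of_mem_primesOver 𝔭.ne_bot P.2⟩,
    HeightOneSpectrum.ext P.2.2.over.symm⟩
  left_inv _ := rfl
  right_inv _ := rfl

instance finite_fiber (𝔭 : HeightOneSpectrum (𝓞 F)) :
    Finite {P : HeightOneSpectrum (𝓞 K) // P.under (𝓞 F) = 𝔭} :=
  have : Finite (𝔭.asIdeal.primesOver (𝓞 K)) :=
    (IsDedekindDomain.primesOver_finite 𝔭.asIdeal (𝓞 K)).to_subtype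
  Finite.of_equiv _ (fiberEquivPrimesOver 𝔭).symm

lemma card_fiber (𝔭 : HeightOneSpectrum (𝓞 F)) :
    Nat.card {P : HeightOneSpectrum (𝓞 K) // P.under (𝓞 F) = 𝔭} =
      (𝔭.asIdeal.primesOver (𝓞 K)).ncard :=
  Nat.card_congr (fiberEquivPrimesOver 𝔭)

/-- With $x=N(\mathfrak p)^{-s}$, the split, inert and ramified cases are $(1-x)^2$,
$1-x^2=(1-x)(1+x)$ and $1-x$. -/
lemma hasProd_fiber (s : ℂ) (𝔭 : HeightOneSpectrum (𝓞 F)) :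
    HasProd (fun P : {P : HeightOneSpectrum (𝓞 K) // P.under (𝓞 F) = 𝔭} =>
      1 - (Ideal.absNorm P.1.asIdeal : ℂ) ^ (-s))
      ((1 - (Ideal.absNorm 𝔭.asIdeal : ℂ) ^ (-s)) *
        (1 - heckeChar K 𝔭 * (Ideal.absNorm 𝔭.asIdeal : ℂ) ^ (-s))) := by
  obtain ⟨f, hf, h⟩ := decomposition K 𝔭
  have := Fintype.ofFinite {P : HeightOneSpectrum (𝓞 K) // P.under (𝓞 F) = 𝔭}
  have h1 : ∀ P : {P : HeightOneSpectrum (𝓞 K) // P.under (𝓞 F) = 𝔭},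
      1 - (Ideal.absNorm P.1.asIdeal : ℂ) ^ (-s) =
        1 - ((Ideal.absNorm 𝔭.asIdeal : ℂ) ^ (-s)) ^ f := fun P => by
    rw [show Ideal.absNorm P.1.asIdeal = _ from hf _ (fiberEquivPrimesOver 𝔭 P).2, Nat.cast_pow, ← Complex.natCast_cpow_natCast_mul,
      mul_comm, Complex.cpow_mul_nat]
  have h2 := hasProd_fintype (fun P : {P : HeightOneSpectrum (𝓞 K) // P.under (𝓞 F) = 𝔭} =>
    1 - (Ideal.absNorm P.1.asIdeal : ℂ) ^ (-s)) (SummationFilter.unconditional _)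
  convert! h2 using 1
  rw [Finset.prod_congr rfl fun P _ => h1 P, Finset.prod_const, Finset.card_univ,
    ← Nat.card_eq_fintype_card, card_fiber]
  rcases h with ⟨hχ, hf, hg⟩ | ⟨hχ, hf, hg⟩ | ⟨hχ, hf, hg⟩ <;> rw [hχ, hf, hg] <;> ring

lemma norm_heckeChar_le (𝔭 : HeightOneSpectrum (𝓞 F)) : ‖heckeChar K 𝔭‖ ≤ 1 := by
  obtain ⟨f, hf, h⟩ := decomposition K 𝔭
  rcases h with ⟨hχ, -, -⟩ | ⟨hχ, -, -⟩ | ⟨hχ, -, -⟩ <;> simp [hχ]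

lemma summable_norm_heckeChar {s : ℂ} (hs : 1 < s.re) :
    Summable fun 𝔭 : HeightOneSpectrum (𝓞 F) =>
      ‖heckeChar K 𝔭 * (Ideal.absNorm 𝔭.asIdeal : ℂ) ^ (-s)‖ := by
  have h := (summable_norm_absNorm_cpow (K := F) hs).comp_injective
    (i := fun 𝔭 : HeightOneSpectrum (𝓞 F) => 𝔭.asIdeal) fun _ _ h => HeightOneSpectrum.ext h
  refine h.of_nonneg_of_le (fun _ => norm_nonneg _) fun 𝔭 => ?_
  rw [norm_mul]
  exact mul_le_of_le_one_left (norm_nonneg _) (norm_heckeChar_le 𝔭)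

variable (F K) in
-- The product for $\zeta_K(s)^{-1}$ is regrouped over the primes of $F$ and compared with that for
-- $\zeta_F(s)^{-1}$. The Hecke product converges separately by absolute summability, and may be
-- inverted since its value $\zeta_F/\zeta_K$ is nonzero.
lemma hasProd_eulerFactor {s : ℂ} (hs : 1 < s.re) :
    HasProd (fun 𝔭 : HeightOneSpectrum (𝓞 F) => eulerFactor K s 𝔭)
      (dedekindZeta K s / dedekindZeta F s) := by
  obtain ⟨hK0, hK⟩ := hasProd_one_sub (K := K) hs
  obtain ⟨hF0, hF⟩ := hasProd_one_sub (K := F) hs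
  have h1 := ((Equiv.hasProd_iff (Equiv.sigmaFiberEquiv
    (fun P : HeightOneSpectrum (𝓞 K) => P.under (𝓞 F)))).mpr hK).sigma
      (fun 𝔭 => hasProd_fiber (K := K) s 𝔭)
  have h2 : Multipliable fun 𝔭 : HeightOneSpectrum (𝓞 F) =>
      1 - heckeChar K 𝔭 * (Ideal.absNorm 𝔭.asIdeal : ℂ) ^ (-s) := by
    simp_rw [sub_eq_add_neg]
    exact multipliable_one_add_of_summable (by simpa using summable_norm_heckeChar (K := K) hs)
  have h3 := h1.unique (hF.mul h2.hasProd)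
  have h4 : ∏' 𝔭 : HeightOneSpectrum (𝓞 F),
      (1 - heckeChar K 𝔭 * (Ideal.absNorm 𝔭.asIdeal : ℂ) ^ (-s)) =
      dedekindZeta F s / dedekindZeta K s := by
    field_simp at h3 ⊢
    rw [h3, mul_comm]
  have h5 := h2.hasProd.inv₀ (by rw [h4]; exact div_ne_zero hF0 hK0)
  rw [h4, inv_div] at h5
  exact h5

variable (F K) in
lemma tendsto_heckeL : Tendsto (fun s : ℝ => heckeL F K (s : ℂ)) (𝓝[>] 1)
    (𝓝 ((dedekindZeta_residue K / dedekindZeta_residue F : ℝ) : ℂ)) := by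
  have hF0 : (dedekindZeta_residue F : ℂ) ≠ 0 :=
    Complex.ofReal_ne_zero.mpr (dedekindZeta_residue_ne_zero F)
  have h := (tendsto_sub_one_mul_dedekindZeta_nhdsGT K).div
    (tendsto_sub_one_mul_dedekindZeta_nhdsGT F) hF0
  rw [Complex.ofReal_div]
  refine h.congr' ?_
  filter_upwards [self_mem_nhdsWithin] with s hs
  have hs' : (1 : ℝ) < (s : ℂ).re := by simpa using hs
  have hs0 : (s : ℂ) - 1 ≠ 0 := by
    rw [sub_ne_zero]
    exact_mod_cast (ne_of_gt hs)
  simp only [Pi.div_apply]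
  rw [heckeL, (hasProd_eulerFactor F K hs').tprod_eq, mul_div_mul_left _ _ hs0]

variable (F K) in
lemma heckeLOne_eq : heckeLOne F K =
    ((dedekindZeta_residue K / dedekindZeta_residue F : ℝ) : ℂ) :=
  (tendsto_heckeL F K).limUnder_eq

end Decomposition

end CMClassNumber

namespace CMClassNumber

open Filter

/-! ### Invariance of class number, zeta function and residue under isomorphism -/

section Transport

variable {F F' : Type*} [Field F] [NumberField F] [Field F'] [NumberField F']

lemma classNumber_eq_of_ringEquiv (e : F ≃+* F') : classNumber F = classNumber F' := by
  unfold classNumber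
  rw [← Nat.card_eq_fintype_card, ← Nat.card_eq_fintype_card]
  exact Nat.card_congr (ClassGroup.mulEquiv (RingOfIntegers.mapRingEquiv e)).toEquiv

lemma dedekindZeta_eq_of_ringEquiv (e : F ≃+* F') : dedekindZeta F = dedekindZeta F' := by
  ext s
  unfold dedekindZeta
  congr 1
  ext n
  congr 1
  let ι := RingOfIntegers.mapRingEquiv e
  refine (Nat.card_congr (Equiv.subtypeEquiv (Ideal.relIsoOfBijective ι ι.bijective).toEquiv
    fun I => ?_)).symm
  have : Ideal.absNorm (Ideal.comap ι I) = Ideal.absNorm I := by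
    refine Nat.card_congr (Ideal.quotientEquiv _ _ ι ?_).toEquiv
    exact (Ideal.map_comap_of_surjective _ ι.surjective I).symm
  rw [← this]
  rfl

lemma dedekindZeta_residue_eq_of_ringEquiv (e : F ≃+* F') :
    dedekindZeta_residue F = dedekindZeta_residue F' := by
  have h1 := tendsto_sub_one_mul_dedekindZeta_nhdsGT F
  have h2 := tendsto_sub_one_mul_dedekindZeta_nhdsGT F'
  rw [dedekindZeta_eq_of_ringEquiv e] at h1
  exact_mod_cast tendsto_nhds_unique h1 h2

end Transport

/-! ### Unit index, regulators and the class number formula -/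

section ClassNumberFormula

/-- The torsion order is even, and a root of unity of order greater than $2$ would exclude every
real place. -/
lemma torsionOrder_of_isTotallyReal (F : Type*) [Field F] [NumberField F] [IsTotallyReal F] :
    Units.torsionOrder F = 2 := by
  have h1 := Units.even_torsionOrder F
  have h0 := Units.torsionOrder_pos F
  obtain ⟨g, hg⟩ := IsCyclic.exists_ofOrder_eq_natCard (α := Units.torsion F)
  by_contra h2
  have h3 : 2 < orderOf g := by
    rw [hg]
    change 2 < Units.torsionOrder F
    obtain ⟨k, hk⟩ := h1
    omega
  have h4 : IsPrimitiveRoot ((g : (𝓞 F)ˣ) : 𝓞 F) (orderOf g) := by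
    rw [← Subgroup.orderOf_coe, ← orderOf_units]
    exact IsPrimitiveRoot.orderOf _
  have h5 : IsPrimitiveRoot (algebraMap (𝓞 F) F ((g : (𝓞 F)ˣ) : 𝓞 F)) (orderOf g) :=
    h4.map_of_injective RingOfIntegers.coe_injective
  have h6 := NumberField.InfinitePlace.IsPrimitiveRoot.nrRealPlaces_eq_zero_of_two_lt h3 h5
  have h7 := IsTotallyReal.finrank F
  rw [h6] at h7
  exact finrank_pos.ne' h7

variable (F K : Type*) [Field F] [NumberField F] [Field K] [NumberField K]
  [Algebra F K] [IsTotallyReal F] [IsTotallyComplex K] [Algebra.IsQuadraticExtension F K]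

lemma unitIndex_eq [IsCMField K] : unitIndex F K = IsCMField.indexRealUnits K := by
  unfold unitIndex IsCMField.indexRealUnits
  rw [sup_comm]
  congr 2
  ext u
  rw [IsCMField.mem_realUnits_iff]
  let e := RingOfIntegers.mapRingEquiv (CMExtension.equivMaximalRealSubfield F K)
  have he : ∀ x : 𝓞 F, algebraMap (𝓞 (maximalRealSubfield K)) (𝓞 K) (e x) =
    algebraMap (𝓞 F) (𝓞 K) x := fun x => by
      ext
      rfl
  constructor
  · rintro ⟨v, rfl⟩
    exact ⟨Units.mapEquiv e.toMulEquiv v, he v⟩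
  · rintro ⟨v, hv⟩
    refine ⟨Units.mapEquiv e.symm.toMulEquiv v, Units.ext ?_⟩
    rw [← hv]
    change algebraMap (𝓞 F) (𝓞 K) (e.symm v) = _
    rw [← he, RingEquiv.apply_symm_apply]

/-- After identifying $F$ with the maximal real subfield of $K$, this is the classical bound on the
Hasse unit index. -/
lemma unitIndex_mem : unitIndex F K ∈ ({1, 2} : Set ℕ) := by
  have := IsCMField.ofCMExtension F K
  rw [unitIndex_eq]
  exact IsCMField.indexRealUnits_eq_one_or_two K

lemma regulator_mul_unitIndex :
    Units.regulator K * unitIndex F K * 2 = 2 ^ finrank ℚ F * Units.regulator F := by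
  have := IsCMField.ofCMExtension F K
  let e := CMExtension.equivMaximalRealSubfield F K
  have h1 := IsCMField.regulator_div_regulator_eq_two_pow_mul_indexRealUnits_inv K
  -- Equality of regulators is read off from equality of the residues: every other factor in the
  -- residue formula is already known to agree for the two isomorphic fields.
  have h2 : Units.regulator F = Units.regulator (maximalRealSubfield K) := by
    have h := dedekindZeta_residue_eq_of_ringEquiv e
    have hn : InfinitePlace.nrRealPlaces F =
        InfinitePlace.nrRealPlaces (maximalRealSubfield K) := by
      rw [← IsTotallyReal.finrank, ← IsTotallyReal.finrank]
      exact LinearEquiv.finrank_eq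
        (AlgEquiv.ofRingEquiv (f := e) (R := ℚ) fun _ => by simp).toLinearEquiv
    rw [dedekindZeta_residue_def, dedekindZeta_residue_def, ← classNumber_eq_of_ringEquiv e,
      ← discr_eq_discr_of_ringEquiv F e, torsionOrder_of_isTotallyReal,
      torsionOrder_of_isTotallyReal, IsTotallyReal.nrComplexPlaces_eq_zero,
      IsTotallyReal.nrComplexPlaces_eq_zero, ← hn] at h
    have hd : √(|discr F| : ℝ) ≠ 0 :=
      (Real.sqrt_pos_of_pos (abs_pos.mpr (Int.cast_ne_zero.mpr (discr_ne_zero F)))).ne'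
    have hh : (classNumber F : ℝ) ≠ 0 := Nat.cast_ne_zero.mpr (classNumber_ne_zero F)
    push_cast at h hd
    field_simp at h
    exact h
  -- $K$ has $n=[F:\mathbb Q]$ complex places and no real ones, so its unit rank is $n-1$; this
  -- turns $2^{\mathrm{rank}}$ into $2^n/2$.
  have h3 : Units.rank K + 1 = finrank ℚ F := by
    have h4 := IsTotallyComplex.finrank K
    rw [← finrank_mul_finrank ℚ F K, Algebra.IsQuadraticExtension.finrank_eq_two F K] at h4
    have h5 : 0 < finrank ℚ F := finrank_pos
    rw [Units.rank, InfinitePlace.card_eq_nrRealPlaces_add_nrComplexPlaces,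
      IsTotallyComplex.nrRealPlaces_eq_zero]
    omega
  have hQ : (unitIndex F K : ℝ) ≠ 0 := by
    rcases unitIndex_mem F K with h | h <;> rw [h] <;> norm_num
  rw [← unitIndex_eq F K, ← h2, div_eq_iff (Units.regulator_ne_zero F)] at h1
  rw [h1, ← h3, pow_succ]
  field_simp

/-- `N` stands for the norm of the relative discriminant. It is kept abstract so that the formula
serves both with $N(\mathfrak I(S))$ and, over $\mathbb Q$, with $|\Delta_K|$. -/
lemma classNumber_formula {N : ℝ} (hN0 : 0 < N)
    (hN : (|discr K| : ℝ) = N * (discr F : ℝ) ^ 2) :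
    (classNumber K : ℂ) =
      ((Units.torsionOrder K * classNumber F * √(|discr F| : ℝ) * unitIndex F K *
        √N / (2 * Real.pi) ^ finrank ℚ F : ℝ) : ℂ) * heckeLOne F K := by
  rw [heckeLOne_eq, ← Complex.ofReal_mul, ← Complex.ofReal_natCast, Complex.ofReal_inj]
  have hR := regulator_mul_unitIndex F K
  have hnF := IsTotallyReal.finrank F
  have hnK : InfinitePlace.nrComplexPlaces K = finrank ℚ F := by
    have h1 := IsTotallyComplex.finrank K
    rw [← finrank_mul_finrank ℚ F K, Algebra.IsQuadraticExtension.finrank_eq_two F K] at h1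
    omega
  have hd : 0 < √(|discr F| : ℝ) :=
    Real.sqrt_pos_of_pos (abs_pos.mpr (Int.cast_ne_zero.mpr (discr_ne_zero F)))
  have hd2 : √(|discr F| : ℝ) * √(|discr F| : ℝ) = |(discr F : ℝ)| :=
    Real.mul_self_sqrt (abs_nonneg _)
  have hK : √(|discr K| : ℝ) = √N * (√(|discr F| : ℝ) * √(|discr F| : ℝ)) := by
    rw [hd2, hN, Real.sqrt_mul hN0.le, Real.sqrt_sq_eq_abs]
  have hsN : 0 < √N := Real.sqrt_pos_of_pos hN0
  have hh : (classNumber F : ℝ) ≠ 0 := Nat.cast_ne_zero.mpr (classNumber_ne_zero F)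
  have hw : (Units.torsionOrder K : ℝ) ≠ 0 := Nat.cast_ne_zero.mpr (Units.torsionOrder_ne_zero K)
  have hRF := Units.regulator_pos F
  rw [dedekindZeta_residue_def, dedekindZeta_residue_def, torsionOrder_of_isTotallyReal F,
    IsTotallyReal.nrComplexPlaces_eq_zero F, IsTotallyComplex.nrRealPlaces_eq_zero, ← hnF, hnK]
  push_cast
  rw [hK]
  field_simp
  linear_combination (-(classNumber K : ℝ)) * hR

end ClassNumberFormula

end CMClassNumber

namespace CMClassNumber

/-! ### Minimal polynomials and the Hessian of the norm form in a basis $1,x$ -/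

section Quadratic

variable {F K : Type*} [Field F] [Field K] [Algebra F K] [Algebra.IsQuadraticExtension F K]

/-- Cayley–Hamilton for multiplication by $x$. -/
lemma sq_sub_trace_mul_add_norm (x : K) :
    x ^ 2 - algebraMap F K (Algebra.trace F K x) * x + algebraMap F K (Algebra.norm F x) = 0 := by
  let b : Basis (Fin 2) F K := finBasisOfFinrankEq F K
    (Algebra.IsQuadraticExtension.finrank_eq_two F K)
  have h := Matrix.aeval_self_charpoly (Algebra.leftMulMatrix b x)
  rw [Matrix.charpoly_fin_two, ← Algebra.trace_eq_matrix_trace b,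
    ← Algebra.norm_eq_matrix_det b, Polynomial.aeval_algHom_apply] at h
  have h2 := (map_eq_zero_iff _ (Algebra.leftMulMatrix_injective b)).mp h
  simpa using h2

open Polynomial in
lemma minpoly_eq_of_notMem_range {x : K} (hx : x ∉ (algebraMap F K).range) :
    minpoly F x = X ^ 2 - C (Algebra.trace F K x) * X + C (Algebra.norm F x) := by
  have hf : (X ^ 2 - C (Algebra.trace F K x) * X + C (Algebra.norm F x)).Monic := by
    monicity!
  have hd : (X ^ 2 - C (Algebra.trace F K x) * X + C (Algebra.norm F x)).natDegree = 2 := by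
    compute_degree!
  have hint : IsIntegral F x := Algebra.IsIntegral.isIntegral x
  have hdvd : minpoly F x ∣ X ^ 2 - C (Algebra.trace F K x) * X + C (Algebra.norm F x) :=
    minpoly.dvd F x (by simpa using sq_sub_trace_mul_add_norm (F := F) x)
  refine (Polynomial.eq_of_monic_of_dvd_of_natDegree_le (minpoly.monic hint) hf hdvd ?_).symm
  rw [hd]
  exact (minpoly.two_le_natDegree_iff hint).mpr hx

/-- The pair `1, x` is a basis of a quadratic extension unless `x` lies in the base field. -/
lemma linearIndependent_one_self {x : K} (hx : x ∉ (algebraMap F K).range) :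
    LinearIndependent F ![(1 : K), x] := by
  rw [LinearIndependent.pair_iff]
  intro s t h
  have ht : t = 0 := by
    by_contra ht
    refine hx ⟨-s / t, ?_⟩
    have : algebraMap F K t ≠ 0 := by simpa using ht
    simp only [Algebra.smul_def, mul_one] at h
    rw [map_div₀, map_neg]
    field_simp
    linear_combination -h
  rw [ht, zero_smul, add_zero, Algebra.smul_def, mul_one] at h
  exact ⟨by simpa using h, ht⟩

end Quadratic

section NormForm

variable {F K : Type*} [Field F] [NumberField F] [Field K] [NumberField K] [Algebra F K]
  [Algebra.IsQuadraticExtension F K]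

lemma trace_algebraMap_eq (a : F) : Algebra.trace F K (algebraMap F K a) = 2 * a := by
  rw [Algebra.trace_algebraMap, Algebra.IsQuadraticExtension.finrank_eq_two, nsmul_eq_mul]
  norm_num

lemma norm_algebraMap_eq (a : F) : Algebra.norm F (algebraMap F K a) = a ^ 2 := by
  rw [Algebra.norm_algebraMap, Algebra.IsQuadraticExtension.finrank_eq_two]

lemma hessianMatrix_one_self_det (x : K) :
    (hessianMatrix (normForm F K) ![1, x]).det =
      4 * Algebra.norm F x - Algebra.trace F K x ^ 2 := by
  have hp : ∀ y z : K, QuadraticMap.polar (normForm F K) y z =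
      Algebra.trace F K y * Algebra.trace F K z - Algebra.trace F K (y * z) := fun y z => by
    have := norm_add_eq (F := F) y z
    change Algebra.norm F (y + z) - Algebra.norm F y - Algebra.norm F z = _
    rw [this]
    ring
  have h1 : Algebra.trace F K 1 = 2 := by
    rw [← map_one (algebraMap F K), trace_algebraMap_eq, mul_one]
  have h2 : QuadraticMap.polar (normForm F K) x x = 2 * Algebra.norm F x := by
    rw [QuadraticMap.polar_self, two_nsmul, two_mul]
    rfl
  rw [Matrix.det_fin_two]
  simp only [hessianMatrix, Matrix.of_apply, Matrix.cons_val_zero, Matrix.cons_val_one, h2]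
  simp only [hp, one_mul, mul_one, h1]
  ring

/-- Links the two sides of the comparison: the right side is the Hessian determinant in the basis
$1,x$, while $2x-T(x)$ is the derivative of the minimal polynomial at $x$. -/
lemma norm_two_mul_sub_trace (x : K) :
    Algebra.norm F (2 * x - algebraMap F K (Algebra.trace F K x)) =
      4 * Algebra.norm F x - Algebra.trace F K x ^ 2 := by
  have h2 : (2 : K) = algebraMap F K 2 := (map_ofNat _ 2).symm
  set t := Algebra.trace F K x with ht
  rw [sub_eq_add_neg, norm_add_eq, h2, ← map_neg, map_mul, norm_algebraMap_eq,
    norm_algebraMap_eq, trace_algebraMap_eq, mul_assoc, mul_comm x, ← Algebra.smul_def,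
    ← Algebra.smul_def, ← Algebra.smul_def, map_smul, map_smul, map_smul, ← ht]
  simp only [smul_eq_mul]
  ring

end NormForm

/-! ### Local monogenicity of $\mathcal O_K$ -/

section LocalBasis

variable {F K : Type*} [Field F] [NumberField F] [Field K] [NumberField K] [Algebra F K]
  [Algebra.IsQuadraticExtension F K]

lemma exists_notMem_range : ∃ θ : K, θ ∉ (algebraMap F K).range := by
  by_contra! h
  have h1 : Function.Surjective (algebraMap F K) := h
  have h2 : finrank F K = 1 := by
    rw [← (LinearEquiv.ofBijective (Algebra.linearMap F K)
      ⟨(algebraMap F K).injective, h1⟩).finrank_eq, finrank_self]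
  rw [Algebra.IsQuadraticExtension.finrank_eq_two] at h2
  norm_num at h2

variable (K) in
/-- Locally at `𝔭`, the ring `𝓞 K` is generated by one element over `𝓞 F`. -/
lemma exists_local_generator (𝔭 : HeightOneSpectrum (𝓞 F)) :
    ∃ ω : 𝓞 K, (ω : K) ∉ (algebraMap F K).range ∧ ∀ y : 𝓞 K, ∃ a b : F,
      𝔭.valuation F a ≤ 1 ∧ 𝔭.valuation F b ≤ 1 ∧
        (y : K) = algebraMap F K a + algebraMap F K b * ω := by
  classical
  obtain ⟨θ, hθ⟩ := exists_notMem_range (F := F) (K := K)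
  let B := basisOfLinearIndependentOfCardEqFinrank (linearIndependent_one_self hθ)
    (by rw [Algebra.IsQuadraticExtension.finrank_eq_two F K]; rfl)
  have hB0 : B 0 = 1 := by simp [B]
  have hB1 : B 1 = θ := by simp [B]
  -- `φ` is a linear functional with kernel exactly $F$; it measures how far an element is from the
  -- base field.
  let φ := B.coord 1
  have hφ0 : ∀ x : K, φ x = 0 → x ∈ (algebraMap F K).range := fun x hx => by
    refine ⟨B.coord 0 x, ?_⟩
    have := B.sum_repr x
    rw [Fin.sum_univ_two, hB0] at this
    have hx' : B.repr x 1 = 0 := hx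
    rw [hx', zero_smul, add_zero, Algebra.smul_def, mul_one] at this
    exact this
  have hφ1 : ∀ a : F, φ (algebraMap F K a) = 0 := fun a => by
    rw [Algebra.algebraMap_eq_smul_one, ← hB0]
    simp [φ]
  obtain ⟨T, hT⟩ := (inferInstance : Module.Finite (𝓞 F) (𝓞 K)).fg_top
  have hspan : ∀ (γ : WithZero (Multiplicative ℤ)),
      (∀ t ∈ T, 𝔭.valuation F (φ (t : K)) ≤ γ) → ∀ y : 𝓞 K, 𝔭.valuation F (φ (y : K)) ≤ γ := by
    intro γ hγ y
    have hy : y ∈ Submodule.span (𝓞 F) (T : Set (𝓞 K)) := by rw [hT]; trivial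
    induction hy using Submodule.span_induction with
    | mem x hx => exact hγ x hx
    | zero => simp
    | add x y _ _ hx hy =>
      rw [show ((x + y : 𝓞 K) : K) = x + y from rfl, map_add]
      exact (Valuation.map_add _ _ _).trans (max_le hx hy)
    | smul r x _ hx =>
      have : ((r • x : 𝓞 K) : K) = (r : F) • (x : K) := by
        rw [Algebra.smul_def, Algebra.smul_def]
        simp only [map_mul]
        rfl
      rw [this, map_smul, smul_eq_mul, map_mul]
      exact (mul_le_of_le_one_left' (𝔭.valuation_le_one r)).trans hx
  have hTne : T.Nonempty := by
    rw [Finset.nonempty_iff_ne_empty]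
    rintro rfl
    simp at hT
  -- `ω` is a generator with `φ` least divisible by $\mathfrak p$. Then $\varphi(y)/\varphi(\omega)$
  -- is $\mathfrak p$-integral for every $y\in\mathcal O_K$, and supplies the coefficient of `ω`.
  obtain ⟨ω, hω, hmax⟩ := T.exists_max_image (fun t => 𝔭.valuation F (φ (t : K))) hTne
  have hle := hspan _ hmax
  have hωφ : φ (ω : K) ≠ 0 := by
    intro h0
    -- A nonzero integer multiple of `θ` lies in $\mathcal O_K$, so `φ` cannot vanish on all of it.
    obtain ⟨n, hn, y, hy⟩ : ∃ n : ℤ, n ≠ 0 ∧ ∃ y : 𝓞 K, (n : K) * θ = y := by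
      obtain ⟨⟨y, d⟩, h⟩ := IsLocalization.surj
        (Algebra.algebraMapSubmonoid (𝓞 K) (nonZeroDivisors ℤ)) θ
      obtain ⟨m, hm, hd⟩ := d.2
      refine ⟨m, nonZeroDivisors.ne_zero hm, y, ?_⟩
      have h3 : algebraMap (𝓞 K) K d = (m : K) := by rw [← hd]; simp
      rw [mul_comm, ← h3]
      exact h
    have h1 := hle y
    rw [h0, map_zero, le_zero_iff, map_eq_zero] at h1
    obtain ⟨c, hc⟩ := hφ0 _ h1
    refine hθ ⟨c / n, ?_⟩
    have : (n : K) ≠ 0 := Int.cast_ne_zero.mpr hn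
    rw [map_div₀, hc, map_intCast, ← hy]
    field_simp
  refine ⟨ω, ?_, fun y => ?_⟩
  · rintro ⟨c, hc⟩
    exact hωφ (by rw [← hc]; exact hφ1 c)
  · have hb : 𝔭.valuation F (φ (y : K) / φ (ω : K)) ≤ 1 := by
      rw [map_div₀]
      exact div_le_one_of_le₀ (hle y) zero_le
    set b := φ (y : K) / φ (ω : K) with hbdef
    obtain ⟨a, ha⟩ : ∃ a : F, algebraMap F K a = (y : K) - algebraMap F K b * ω := by
      refine hφ0 _ ?_
      rw [map_sub, ← Algebra.smul_def, map_smul, smul_eq_mul, hbdef]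
      field_simp
      simp
    refine ⟨a, b, ?_, hb, by rw [ha]; ring⟩
    -- Integrality of `a`: multiplying by an `s` prime to $\mathfrak p$ that clears the denominator
    -- of `b` makes $as$ an algebraic integer of $F$, while `s` has valuation $1$.
    obtain ⟨c, s, hc⟩ := 𝔭.exists_primeCompl_mul_eq_of_integer b hb
    have h1 : algebraMap F K (a * (s : 𝓞 F)) =
        ((algebraMap (𝓞 F) (𝓞 K) s * y - algebraMap (𝓞 F) (𝓞 K) c * ω : 𝓞 K) : K) := by
      rw [map_mul, ha]
      change _ = algebraMap F K (algebraMap (𝓞 F) F s) * y -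
        algebraMap F K (algebraMap (𝓞 F) F c) * ω
      rw [← hc, map_mul]
      ring
    have h3 : IsIntegral ℤ (a * (s : 𝓞 F) : F) := by
      rw [← isIntegral_algebraMap_iff (algebraMap F K).injective, h1]
      exact RingOfIntegers.isIntegral_coe _
    have h4 : 𝔭.valuation F (a * (s : 𝓞 F) : F) ≤ 1 := 𝔭.valuation_le_one ⟨_, h3⟩
    have h5 : 𝔭.valuation F ((s : 𝓞 F) : F) = 1 := by
      rw [HeightOneSpectrum.valuation_of_algebraMap]
      exact (𝔭.intValuation_eq_one_iff_mem_primeCompl _).mpr s.2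
    rwa [map_mul, h5, mul_one] at h4

end LocalBasis

end CMClassNumber

namespace CMClassNumber

/-! ### The associated ideal of the Hessian determinant is the relative discriminant -/

section Different

variable {F K : Type*} [Field F] [NumberField F] [Field K] [NumberField K] [Algebra F K]
  [Algebra.IsQuadraticExtension F K]

lemma count_span_singleton (𝔭 : HeightOneSpectrum (𝓞 F)) {r : 𝓞 F} (hr : r ≠ 0) :
    FractionalIdeal.count F 𝔭 (Ideal.span {r} : Ideal (𝓞 F)) =
      -WithZero.log (𝔭.valuation F (algebraMap (𝓞 F) F r)) := by
  rw [FractionalIdeal.count_coe F 𝔭 (by simpa using hr)]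
  have := 𝔭.valuation_of_algebraMap (K := F) r
  rw [this, 𝔭.intValuation_if_neg hr, WithZero.log_exp, neg_neg]

lemma two_mul_sub_trace_ne_zero {x : K} (hx : x ∉ (algebraMap F K).range) :
    2 * x - algebraMap F K (Algebra.trace F K x) ≠ 0 := by
  intro h
  refine hx ⟨Algebra.trace F K x / 2, ?_⟩
  rw [map_div₀, map_ofNat]
  linear_combination (-1/2 : K) * h

lemma four_mul_norm_sub_ne_zero {x : K} (hx : x ∉ (algebraMap F K).range) :
    4 * Algebra.norm F x - Algebra.trace F K x ^ 2 ≠ 0 := by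
  rw [← norm_two_mul_sub_trace]
  exact Algebra.norm_ne_zero_iff.mpr (two_mul_sub_trace_ne_zero hx)

lemma adjoin_singleton_eq_top {x : K} (hx : x ∉ (algebraMap F K).range) :
    Algebra.adjoin F {x} = ⊤ := by
  have h := (linearIndependent_one_self hx).span_eq_top_of_card_eq_finrank'
    (by rw [Algebra.IsQuadraticExtension.finrank_eq_two F K]; rfl)
  rw [← Algebra.toSubmodule_eq_top, eq_top_iff, ← h, Submodule.span_le]
  rintro _ ⟨i, rfl⟩
  fin_cases i
  · exact one_mem (Algebra.adjoin F {x})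
  · exact Algebra.self_mem_adjoin_singleton F x

open Polynomial in
lemma algebraMap_aeval_derivative_minpoly {ω : 𝓞 K} (hω : (ω : K) ∉ (algebraMap F K).range) :
    algebraMap (𝓞 K) K (aeval ω (derivative (minpoly (𝓞 F) ω))) =
      2 * ω - algebraMap F K (Algebra.trace F K ω) := by
  have h := minpoly.isIntegrallyClosed_eq_field_fractions (R := 𝓞 F) F K
    (Algebra.IsIntegral.isIntegral (R := 𝓞 F) ω)
  have h1 : minpoly F (algebraMap (𝓞 K) K ω) = _ := minpoly_eq_of_notMem_range hω
  rw [← aeval_algebraMap_apply, ← aeval_map_algebraMap F, ← derivative_map, ← h, h1]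
  simp [one_add_one_eq_two]
  exact Or.inl (map_ofNat _ 2)

/-- The conductor of an element that generates `𝓞 K` locally at `𝔭` is prime to `𝔭`. -/
lemma exists_primeCompl_mem_conductor {𝔭 : HeightOneSpectrum (𝓞 F)} {ω : 𝓞 K}
    (hω : ∀ y : 𝓞 K, ∃ a b : F, 𝔭.valuation F a ≤ 1 ∧ 𝔭.valuation F b ≤ 1 ∧
        (y : K) = algebraMap F K a + algebraMap F K b * ω) :
    ∃ s : 𝔭.asIdeal.primeCompl, algebraMap (𝓞 F) (𝓞 K) s ∈ conductor (𝓞 F) ω := by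
  classical
  have h1 : ∀ y : 𝓞 K, ∃ s : 𝔭.asIdeal.primeCompl,
      algebraMap (𝓞 F) (𝓞 K) s * y ∈ Algebra.adjoin (𝓞 F) {ω} := by
    intro y
    obtain ⟨a, b, ha, hb, hy⟩ := hω y
    obtain ⟨m, s, hs⟩ := 𝔭.exists_primeCompl_mul_eq_of_integer a ha
    obtain ⟨n, t, ht⟩ := 𝔭.exists_primeCompl_mul_eq_of_integer b hb
    refine ⟨s * t, ?_⟩
    have : algebraMap (𝓞 F) (𝓞 K) ((s * t : 𝔭.asIdeal.primeCompl) : 𝓞 F) * y =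
        algebraMap (𝓞 F) (𝓞 K) (m * t) + algebraMap (𝓞 F) (𝓞 K) (n * s) * ω := by
      apply RingOfIntegers.ext
      change algebraMap F K (algebraMap (𝓞 F) F (s * t)) * y =
        algebraMap F K (algebraMap (𝓞 F) F (m * t)) +
          algebraMap F K (algebraMap (𝓞 F) F (n * s)) * ω
      rw [hy, map_mul (algebraMap (𝓞 F) F) m, map_mul (algebraMap (𝓞 F) F) n, ← hs, ← ht]
      simp only [map_mul]
      ring
    rw [this]
    exact add_mem (Subalgebra.algebraMap_mem _ _) (mul_mem (Subalgebra.algebraMap_mem _ _)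
      (Algebra.self_mem_adjoin_singleton _ _))
  choose s hs using h1
  obtain ⟨T, hT⟩ := (inferInstance : Module.Finite (𝓞 F) (𝓞 K)).fg_top
  -- A common denominator: the product over a finite generating set works for every generator, hence
  -- by linearity for all of $\mathcal O_K$.
  refine ⟨∏ t ∈ T, s t, ?_⟩
  rw [mem_conductor_iff]
  intro y
  have hy : y ∈ Submodule.span (𝓞 F) (T : Set (𝓞 K)) := by rw [hT]; trivial
  induction hy using Submodule.span_induction with
  | mem x hx =>
    rw [← Finset.prod_erase_mul T s hx, Submonoid.coe_mul, map_mul, mul_assoc]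
    exact mul_mem (Subalgebra.algebraMap_mem _ _) (hs x)
  | zero => simp
  | add x y _ _ hx hy =>
    rw [mul_add]
    exact add_mem hx hy
  | smul r x _ hx =>
    rw [mul_smul_comm]
    exact Subalgebra.smul_mem _ hx r

/-- Take relative norms in conductor · different $=(f'(\omega))$. The conductor contributes nothing
at $\mathfrak p$, and the norm of $f'(\omega)$ is $4N(\omega)-T(\omega)^2$. -/
lemma count_relNorm_differentIdeal {𝔭 : HeightOneSpectrum (𝓞 F)} {ω : 𝓞 K}
    (hω : (ω : K) ∉ (algebraMap F K).range)
    (hgen : ∀ y : 𝓞 K, ∃ a b : F, 𝔭.valuation F a ≤ 1 ∧ 𝔭.valuation F b ≤ 1 ∧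
        (y : K) = algebraMap F K a + algebraMap F K b * ω) :
    FractionalIdeal.count F 𝔭 (Ideal.relNorm (𝓞 F) (differentIdeal (𝓞 F) (𝓞 K)) :
        Ideal (𝓞 F)) =
      -WithZero.log (𝔭.valuation F
        (4 * Algebra.norm F (ω : K) - Algebra.trace F K (ω : K) ^ 2)) := by
  set d := Polynomial.aeval ω (Polynomial.derivative (minpoly (𝓞 F) ω)) with hd
  have h1 := conductor_mul_differentIdeal (𝓞 F) F K ω (adjoin_singleton_eq_top hω)
  rw [← hd] at h1
  have hnorm : algebraMap (𝓞 F) F (Algebra.intNorm (𝓞 F) (𝓞 K) d) =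
      4 * Algebra.norm F (ω : K) - Algebra.trace F K (ω : K) ^ 2 := by
    rw [Algebra.algebraMap_intNorm (L := K), algebraMap_aeval_derivative_minpoly hω,
      norm_two_mul_sub_trace]
  have hd0 : Algebra.intNorm (𝓞 F) (𝓞 K) d ≠ 0 := fun h0 => by
    rw [h0, map_zero] at hnorm
    exact four_mul_norm_sub_ne_zero hω hnorm.symm
  have h2 := congrArg (Ideal.relNorm (𝓞 F)) h1
  rw [map_mul, Ideal.relNorm_singleton] at h2
  have h3 : Ideal.relNorm (𝓞 F) (conductor (𝓞 F) ω) ≠ ⊥ ∧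
      Ideal.relNorm (𝓞 F) (differentIdeal (𝓞 F) (𝓞 K)) ≠ ⊥ := by
    constructor <;> intro h0 <;> rw [h0] at h2
    · rw [Ideal.bot_mul, eq_comm, Ideal.span_singleton_eq_bot] at h2
      exact hd0 h2
    · rw [Ideal.mul_bot, eq_comm, Ideal.span_singleton_eq_bot] at h2
      exact hd0 h2
  -- The conductor contains some `s` in $\mathcal O_F$ outside $\mathfrak p$, so its norm contains
  -- $s^2$, a unit at $\mathfrak p$.
  have hcond : FractionalIdeal.count F 𝔭
      (Ideal.relNorm (𝓞 F) (conductor (𝓞 F) ω) : Ideal (𝓞 F)) = 0 := by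
    obtain ⟨s, hs⟩ := exists_primeCompl_mem_conductor hgen
    have hs1 : 𝔭.valuation F (algebraMap (𝓞 F) F (s : 𝓞 F)) = 1 := by
      have := 𝔭.valuation_of_algebraMap (K := F) (s : 𝓞 F)
      rw [this]
      exact (𝔭.intValuation_eq_one_iff_mem_primeCompl _).mpr s.2
    have hN : algebraMap (𝓞 F) F (Algebra.intNorm (𝓞 F) (𝓞 K) (algebraMap (𝓞 F) (𝓞 K) s)) =
        (algebraMap (𝓞 F) F (s : 𝓞 F)) ^ 2 := by
      rw [Algebra.algebraMap_intNorm (L := K)]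
      exact norm_algebraMap_eq _
    have hN0 : Algebra.intNorm (𝓞 F) (𝓞 K) (algebraMap (𝓞 F) (𝓞 K) s) ≠ 0 := fun h0 => by
      rw [h0, map_zero] at hN
      have := congrArg (𝔭.valuation F) hN
      rw [map_zero, map_pow, hs1] at this
      simp at this
    have hle : Ideal.span {Algebra.intNorm (𝓞 F) (𝓞 K) (algebraMap (𝓞 F) (𝓞 K) s)} ≤
        Ideal.relNorm (𝓞 F) (conductor (𝓞 F) ω) := by
      rw [← Ideal.relNorm_singleton]
      exact Ideal.relNorm_mono _ ((Ideal.span_singleton_le_iff_mem _).mpr hs)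
    refine le_antisymm ?_ (FractionalIdeal.count_coe_nonneg F 𝔭 _)
    refine (FractionalIdeal.count_mono F 𝔭 ?_ (FractionalIdeal.coeIdeal_le_coeIdeal F |>.mpr
      hle)).trans ?_
    · rw [FractionalIdeal.coeIdeal_ne_zero, Ne, Ideal.span_singleton_eq_bot]
      exact hN0
    · rw [count_span_singleton 𝔭 hN0, hN, map_pow, hs1]
      simp
  have h4 := count_span_singleton 𝔭 hd0
  rw [← h2, FractionalIdeal.coeIdeal_mul, FractionalIdeal.count_mul F 𝔭
    (FractionalIdeal.coeIdeal_ne_zero.mpr h3.1) (FractionalIdeal.coeIdeal_ne_zero.mpr h3.2),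
    hcond, zero_add, hnorm] at h4
  exact h4

open scoped Classical in
lemma ord_detH {𝔭 : HeightOneSpectrum (𝓞 F)} {ω : 𝓞 K}
    (hω : (ω : K) ∉ (algebraMap F K).range)
    (hgen : ∀ y : 𝓞 K, ∃ a b : F, 𝔭.valuation F a ≤ 1 ∧ 𝔭.valuation F b ≤ 1 ∧
        (y : K) = algebraMap F K a + algebraMap F K b * ω) :
    ord 𝔭 (detH F K) = -WithZero.log (𝔭.valuation F
        (4 * Algebra.norm F (ω : K) - Algebra.trace F K (ω : K) ^ 2)) := by
  let v : Fin 2 → K := ![1, ω]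
  let w : Fin 2 → 𝔭.adicCompletion F ⊗[F] K := fun i => (1 : 𝔭.adicCompletion F) ⊗ₜ[F] v i
  let B := basisOfLinearIndependentOfCardEqFinrank (linearIndependent_one_self hω)
    (by rw [Algebra.IsQuadraticExtension.finrank_eq_two F K]; rfl)
  have hw : LinearIndependent (𝔭.adicCompletion F) w := by
    have := (B.baseChange (𝔭.adicCompletion F)).linearIndependent
    convert this using 1
    ext i
    simp [w, v, B]
  have hw' : LinearIndependent (𝔭.adicCompletionIntegers F) w :=
    (LinearIndependent.iff_fractionRing (R := 𝔭.adicCompletionIntegers F)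
      (K := 𝔭.adicCompletion F)).mpr hw
  -- The images of $1$ and `ω` span the local lattice: both lie in $\mathcal O_K$, and `hgen`
  -- expresses every integer through them with $\mathfrak p$-integral coefficients.
  have hL : Submodule.span (𝔭.adicCompletionIntegers F) (Set.range w) =
      localLattice (ringLattice F K) 𝔭 := by
    refine le_antisymm (Submodule.span_le.mpr ?_)
      (localLattice_le (ringLattice F K) _ (Submodule.span_eq _) 𝔭 _ fun t ht => ?_)
    · rintro _ ⟨i, rfl⟩
      refine Submodule.subset_span ⟨v i, ?_, rfl⟩
      fin_cases i
      · exact ⟨1, map_one (algebraMap (𝓞 K) K)⟩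
      · exact ⟨ω, rfl⟩
    · obtain ⟨y, rfl⟩ := ht
      obtain ⟨a, b, ha, hb, hy⟩ := hgen y
      have hy' : (IsScalarTower.toAlgHom (𝓞 F) (𝓞 K) K).toLinearMap y =
          a • v 0 + b • v 1 := by
        change (y : K) = a • (1 : K) + b • (ω : K)
        rw [hy, Algebra.smul_def, Algebra.smul_def, mul_one]
      rw [hy', TensorProduct.tmul_add]
      obtain ⟨s, hs⟩ := integral_smul_tmul 𝔭 a ha (v 0)
      obtain ⟨t, ht⟩ := integral_smul_tmul 𝔭 b hb (v 1)
      rw [hs, ht]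
      exact add_mem (Submodule.smul_mem _ _ (Submodule.subset_span ⟨0, rfl⟩))
        (Submodule.smul_mem _ _ (Submodule.subset_span ⟨1, rfl⟩))
  let b' := (Basis.span hw').map (LinearEquiv.ofEq _ _ hL)
  have hb' : (fun i => ((b' i : localLattice (ringLattice F K) 𝔭) :
      𝔭.adicCompletion F ⊗[F] K)) = w := by
    ext i
    simp [b', Basis.span_apply]
  have hδ0 := four_mul_norm_sub_ne_zero hω
  have hdet : algebraMap F (𝔭.adicCompletion F)
      (4 * Algebra.norm F (ω : K) - Algebra.trace F K (ω : K) ^ 2) =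
      (hessianMatrix (localForm (normForm F K) 𝔭) fun i =>
        ((b' i : localLattice (ringLattice F K) 𝔭) : 𝔭.adicCompletion F ⊗[F] K)).det := by
    rw [hb', ← hessianMatrix_one_self_det, RingHom.map_det]
    congr 1
    exact Matrix.ext fun i j => (localForm_polar (normForm F K) 𝔭 _ _).symm
  have := component_hessianDet (normForm F K) (normForm_nondegenerate F K) (ringLattice F K) 𝔭 b'
    (Units.mk0 _ ((map_ne_zero _).mpr hδ0)) hdet
  unfold ord detH
  rw [this]
  change -WithZero.log (Valued.v (algebraMap F (𝔭.adicCompletion F)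
      (4 * Algebra.norm F (ω : K) - Algebra.trace F K (ω : K) ^ 2))) = _
  congr 2
  exact HeightOneSpectrum.valuedAdicCompletion_eq_valuation' 𝔭 _

variable (F K)

/-- The ideal of the Hessian determinant of the norm form is the relative discriminant. -/
theorem assocIdeal_detH :
    assocIdeal (detH F K) =
      (Ideal.relNorm (𝓞 F) (differentIdeal (𝓞 F) (𝓞 K)) : Ideal (𝓞 F)) := by
  have hD : (Ideal.relNorm (𝓞 F) (differentIdeal (𝓞 F) (𝓞 K)) : Ideal (𝓞 F)) ≠ ⊥ := by
    rw [Ne, Ideal.relNorm_eq_bot_iff]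
    exact differentIdeal_ne_bot
  rw [← FractionalIdeal.finprod_heightOneSpectrum_factorization' F
    (FractionalIdeal.coeIdeal_ne_zero.mpr hD)]
  refine finprod_congr fun 𝔭 => ?_
  obtain ⟨ω, hω, hgen⟩ := exists_local_generator K 𝔭
  rw [ord_detH hω hgen, count_relNorm_differentIdeal hω hgen]

/-- The tower formula for discriminants, with the absolute norm of the different equal to that of
its relative norm. -/
theorem absNorm_assocIdeal_detH :
    0 < FractionalIdeal.absNorm (assocIdeal (detH F K)) ∧
      (|discr K| : ℚ) = FractionalIdeal.absNorm (assocIdeal (detH F K)) * (discr F : ℚ) ^ 2 := by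
  have h := natAbs_discr_eq_absNorm_differentIdeal_mul_natAbs_discr_pow F (𝓞 F) K (𝓞 K)
  rw [Algebra.IsQuadraticExtension.finrank_eq_two F K] at h
  rw [assocIdeal_detH, FractionalIdeal.coeIdeal_absNorm, Ideal.absNorm_relNorm]
  constructor
  · rw [Nat.cast_pos, Nat.pos_iff_ne_zero, Ne, Ideal.absNorm_eq_zero_iff]
    exact differentIdeal_ne_bot
  · have h2 := congrArg (Nat.cast : ℕ → ℚ) h
    push_cast [Nat.cast_natAbs] at h2
    rw [sq_abs] at h2
    exact_mod_cast h2

end Different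

end CMClassNumber

namespace CMClassNumber

/-! ### The Kronecker symbol of a negative discriminant as a Dirichlet character -/

section Kronecker

/-- A multiplicative function of period `m` that vanishes off the integers prime to `m` is a
Dirichlet character modulo `m`. -/
lemma exists_dirichletCharacter_of_periodic {m : ℕ} [NeZero m] (f : ℕ → ℤ) (h1 : f 1 = 1)
    (hmul : ∀ a b, a ≠ 0 → b ≠ 0 → f (a * b) = f a * f b) (hmod : ∀ a, f a = f (a % m))
    (h0 : ∀ a, ¬ a.Coprime m → f a = 0) :
    ∃ χ : DirichletCharacter ℂ m, ∀ n : ℕ, χ n = (f n : ℂ) := by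
  -- Shifting by the period replaces any argument by a nonzero one, which removes the restriction in
  -- `hmul`.
  have hadd : ∀ a, f a = f (a + m) := fun a => by rw [hmod, hmod (a + m), Nat.add_mod_right]
  have hmul' : ∀ a b, f (a * b) = f a * f b := fun a b => by
    have hm : m ≠ 0 := NeZero.ne m
    rw [hadd a, hadd b, ← hmul _ _ (by omega) (by omega), hmod, hmod ((a + m) * (b + m))]
    congr 1
    simp [Nat.mul_mod]
  refine ⟨MulChar.mk ⟨⟨fun x => (f x.val : ℂ), ?_⟩, fun x y => ?_⟩ fun x hx => ?_, fun n => ?_⟩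
  · have : f (1 : ZMod m).val = 1 := by rw [ZMod.val_one_eq_one_mod, ← hmod, h1]
    exact_mod_cast this
  · have : f (x * y).val = f x.val * f y.val := by rw [ZMod.val_mul, ← hmod, hmul']
    change ((f (x * y).val : ℤ) : ℂ) = f x.val * f y.val
    exact_mod_cast this
  · have : f x.val = 0 := h0 _ fun h => hx (by
      rw [← ZMod.natCast_zmod_val x]
      exact (ZMod.isUnit_iff_coprime _ _).mpr h)
    change ((f x.val : ℤ) : ℂ) = 0
    exact_mod_cast this
  · have : f (n : ZMod m).val = f n := by rw [ZMod.val_natCast, ← hmod]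
    change ((f (n : ZMod m).val : ℤ) : ℂ) = f n
    rw [this]

lemma eq_kronecker_of_mul {D : ℤ} (f : ℕ → ℤ) (h1 : f 1 = 1)
    (hmul : ∀ a b, a ≠ 0 → b ≠ 0 → f (a * b) = f a * f b)
    (hprime : ∀ p, p.Prime → f p = kroneckerPrime D p) {n : ℕ} (hn : n ≠ 0) :
    f n = kronecker D n := by
  have : ∀ l : List ℕ, (∀ p ∈ l, p.Prime) → f l.prod = (l.map (kroneckerPrime D)).prod := by
    intro l hl
    induction l with
    | nil => simpa using h1
    | cons p l ih =>
      rw [List.prod_cons, List.map_cons, List.prod_cons, hmul _ _ (hl p (by simp)).ne_zero,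
        hprime p (hl p (by simp)), ih fun q hq => hl q (by simp [hq])]
      exact List.prod_ne_zero fun h => Nat.not_prime_zero (hl 0 (by simp [h]))
  rw [← Nat.prod_primeFactorsList hn, this _ fun p hp => Nat.prime_of_mem_primeFactorsList hp,
    Nat.prod_primeFactorsList hn]
  rfl

/-- For $m\equiv3\pmod 4$ the sign $(-1/n)$ cancels the sign in quadratic reciprocity. -/
lemma jacobiSym_neg_of_three_mod_four {m n : ℕ} (hm : m % 4 = 3) (hn : Odd n) :
    jacobiSym (-m) n = jacobiSym n m := by
  rw [jacobiSym.neg _ hn, ZMod.χ₄_nat_eq_if_mod_four]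
  have hn2 := Nat.odd_iff.mp hn
  rw [if_neg (by omega)]
  split_ifs with h
  · rw [one_mul, jacobiSym.quadratic_reciprocity_one_mod_four' (Nat.odd_iff.mpr (by omega)) h]
  · rw [jacobiSym.quadratic_reciprocity_three_mod_four hm (by omega)]
    ring

/-- The Kronecker symbol of a negative discriminant is a Dirichlet character. -/
theorem exists_dirichletCharacter_eq_kronecker {D : ℤ} (hD : D < 0) (h4 : D % 4 = 0 ∨ D % 4 = 1)
    {m : ℕ} [NeZero m] (hm : m = D.natAbs) :
    ∃ χ : DirichletCharacter ℂ m, ∀ n : ℕ, 1 ≤ n → χ n = (kronecker D n : ℂ) := by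
  suffices ∃ f : ℕ → ℤ, f 1 = 1 ∧ (∀ a b, a ≠ 0 → b ≠ 0 → f (a * b) = f a * f b) ∧
      (∀ a, f a = f (a % m)) ∧ (∀ a, ¬ a.Coprime m → f a = 0) ∧
      ∀ p, p.Prime → f p = kroneckerPrime D p by
    obtain ⟨f, h1, hmul, hmod, h0, hprime⟩ := this
    obtain ⟨χ, hχ⟩ := exists_dirichletCharacter_of_periodic f h1 hmul hmod h0
    exact ⟨χ, fun n hn => by
      rw [hχ, eq_kronecker_of_mul f h1 hmul hprime (Nat.one_le_iff_ne_zero.mp hn)]⟩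
  have hm0 : m ≠ 0 := NeZero.ne m
  rcases h4 with h4 | h4
  · obtain ⟨d, hd⟩ : ∃ d : ℤ, D = 4 * d := Int.dvd_of_emod_eq_zero h4
    have hmd : m = 4 * d.natAbs := by omega
    -- For $D=4d$ the symbol is $(d/n)$ on odd $n$, where it has period $4|d|=m$, and zero on even
    -- $n$.
    refine ⟨fun n => if n % 2 = 0 then 0 else jacobiSym d n, by simp, fun a b ha hb => ?_,
      fun a => ?_, fun a ha => ?_, fun p hp => ?_⟩
    · have := Nat.mul_mod a b 2
      rcases Nat.mod_two_eq_zero_or_one a with h | h <;>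
        rcases Nat.mod_two_eq_zero_or_one b with h' | h' <;>
        simp [this, h, h', jacobiSym.mul_right' d ha hb]
    · have h2 : a % m % 2 = a % 2 := Nat.mod_mod_of_dvd a ⟨2 * d.natAbs, by omega⟩
      simp only [h2]
      split_ifs with h
      · rfl
      · rw [jacobiSym.mod_right d (Nat.odd_iff.mpr (by omega)), ← hmd]
    · dsimp only
      split_ifs with h
      · rfl
      · have : NeZero a := ⟨by rintro rfl; simp at h⟩
        rw [jacobiSym.eq_zero_iff_not_coprime]
        intro hc
        refine ha ?_
        rw [hmd]
        refine Nat.Coprime.mul_right ?_ ?_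
        · rw [show (4 : ℕ) = 2 ^ 2 from rfl]
          exact Nat.Coprime.pow_right 2 (Nat.coprime_two_right.mpr (Nat.odd_iff.mpr (by omega)))
        · exact Nat.Coprime.symm hc
    · dsimp only
      rw [kroneckerPrime]
      rcases hp.eq_two_or_odd with h | h
      · rw [if_pos (by omega), if_pos h, if_pos (by omega)]
      · rw [if_neg (by omega), if_neg (by omega), hd, jacobiSym.mul_left, jacobiSym.at_four (Nat.odd_iff.mpr (by omega)), one_mul]
  · have hm4 : m % 4 = 3 := by omega
    have hDm : D = -(m : ℤ) := by omega
    -- For $D\equiv1\pmod4$ negative, $m=-D\equiv3\pmod4$ and the symbol is $(n/m)$, visibly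
    -- periodic. Reciprocity identifies it at odd primes, and $(2/m)$ depends on $m$ modulo $8$ as
    -- required.
    refine ⟨fun n => jacobiSym n m, by simp, fun a b _ _ => ?_, fun a => ?_, fun a ha => ?_,
      fun p hp => ?_⟩
    · simp [jacobiSym.mul_left]
    · dsimp only
      rw [jacobiSym.mod_left, Int.natCast_mod]
    · exact jacobiSym.eq_zero_iff_not_coprime.mpr ha
    · dsimp only
      rw [kroneckerPrime]
      split_ifs with h h' h''
      · omega
      · rw [h, Nat.cast_ofNat, jacobiSym.at_two (Nat.odd_iff.mpr (by omega)),
          ZMod.χ₈_nat_eq_if_mod_eight, if_neg (by omega), if_pos (by omega)]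
      · rw [h, Nat.cast_ofNat, jacobiSym.at_two (Nat.odd_iff.mpr (by omega)),
          ZMod.χ₈_nat_eq_if_mod_eight, if_neg (by omega), if_neg (by omega)]
      · rw [hDm, jacobiSym_neg_of_three_mod_four hm4 (hp.odd_of_ne_two h)]

end Kronecker

end CMClassNumber

namespace CMClassNumber

/-! ### Quadratic fields over $\mathbb Q$: integral bases and primes of norm $p$ -/

section QuadraticField

variable (K : Type*) [Field K] [NumberField K] [Algebra.IsQuadraticExtension ℚ K]

/-- The element $1$ is primitive in $\mathcal O_K$: an integer dividing it is a unit, hence $\pm1$.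
A Bézout relation then completes it to a basis. -/
lemma exists_int_basis : ∃ b : Basis (Fin 2) ℤ (𝓞 K), b 0 = 1 := by
  have hrank : finrank ℤ (𝓞 K) = 2 := by
    rw [RingOfIntegers.rank, Algebra.IsQuadraticExtension.finrank_eq_two]
  let b : Basis (Fin 2) ℤ (𝓞 K) := finBasisOfFinrankEq ℤ (𝓞 K) hrank
  have h1 := b.sum_repr 1
  rw [Fin.sum_univ_two] at h1
  set m := b.repr 1 0 with hm
  set n := b.repr 1 1 with hn
  have hcop : IsCoprime m n := by
    rw [Int.isCoprime_iff_gcd_eq_one]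
    obtain ⟨m', hm'⟩ := Int.gcd_dvd_left m n
    obtain ⟨n', hn'⟩ := Int.gcd_dvd_right m n
    have h2 : ((Int.gcd m n : ℤ) : 𝓞 K) * (m' • b 0 + n' • b 1) = 1 := by
      rw [← h1, ← zsmul_eq_mul, smul_add, smul_smul, smul_smul, ← hm', ← hn']
    have h3 : IsUnit ((Int.gcd m n : ℤ) : 𝓞 K) := IsUnit.of_mul_eq_one _ h2
    have h4 : IsUnit (Algebra.norm ℤ ((Int.gcd m n : ℤ) : 𝓞 K)) := h3.map _
    rw [← eq_intCast (algebraMap ℤ (𝓞 K)), Algebra.norm_algebraMap, hrank] at h4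
    have h5 := (isUnit_pow_iff two_ne_zero).mp h4
    rwa [Int.isUnit_iff_natAbs_eq, Int.natAbs_natCast] at h5
  obtain ⟨u, v, huv⟩ := hcop
  -- With $um+vn=1$, the matrix with rows $(m,n)$ and $(-v,u)$ has determinant $1$; the two
  -- identities below are its inverse.
  let w : Fin 2 → 𝓞 K := ![1, (-v) • b 0 + u • b 1]
  have hb0 : b 0 = u • w 0 + (-n) • w 1 := by
    simp only [w, Matrix.cons_val_zero, Matrix.cons_val_one, ← h1]
    rw [smul_add, smul_add, smul_smul, smul_smul, smul_smul, smul_smul]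
    have : b 0 = (u * m + v * n) • b 0 := by rw [huv, one_smul]
    conv_lhs => rw [this]
    module
  have hb1 : b 1 = v • w 0 + m • w 1 := by
    simp only [w, Matrix.cons_val_zero, Matrix.cons_val_one, ← h1]
    have : b 1 = (u * m + v * n) • b 1 := by rw [huv, one_smul]
    conv_lhs => rw [this]
    module
  have hspan : ⊤ ≤ Submodule.span ℤ (Set.range w) := by
    rw [← b.span_eq, Submodule.span_le]
    have hw : ∀ i, w i ∈ Submodule.span ℤ (Set.range w) := fun i => Submodule.subset_span ⟨i, rfl⟩
    rintro _ ⟨i, rfl⟩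
    fin_cases i
    · exact hb0 ▸ add_mem (Submodule.smul_mem _ _ (hw 0)) (Submodule.smul_mem _ _ (hw 1))
    · exact hb1 ▸ add_mem (Submodule.smul_mem _ _ (hw 0)) (Submodule.smul_mem _ _ (hw 1))
  refine ⟨basisOfTopLeSpanOfCardEqFinrank w hspan (by rw [hrank]; rfl), ?_⟩
  simp [w]

variable {K}

/-- The discriminant of a quadratic field whose ring of integers is `ℤ[ω]`, `ω² = Tω - N`. -/
lemma discr_eq_of_basis (b : Basis (Fin 2) ℤ (𝓞 K)) (h0 : b 0 = 1) {T N : ℤ}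
    (h1 : b 1 * b 1 = T * b 1 - N) : discr K = T ^ 2 - 4 * N := by
  have ht0 : Algebra.trace ℤ (𝓞 K) 1 = 2 := by
    rw [← map_one (algebraMap ℤ (𝓞 K)), Algebra.trace_algebraMap, RingOfIntegers.rank,
      Algebra.IsQuadraticExtension.finrank_eq_two]
    norm_num
  have ht1 : Algebra.trace ℤ (𝓞 K) (b 1) = T := by
    have e1 : b.repr (b 1 * b 1) 1 = T := by
      have : b 1 * b 1 = T • b 1 + (-N) • b 0 := by
        rw [h1, h0, zsmul_eq_mul, zsmul_eq_mul]
        push_cast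
        ring
      rw [this, map_add, map_smul, map_smul, b.repr_self, b.repr_self]
      simp
    rw [Algebra.trace_eq_matrix_trace b, Matrix.trace_fin_two, Algebra.leftMulMatrix_eq_repr_mul,
      Algebra.leftMulMatrix_eq_repr_mul, e1, h0, mul_one]
    simp
  have ht2 : Algebra.trace ℤ (𝓞 K) (b 1 * b 1) = T ^ 2 - 2 * N := by
    have : b 1 * b 1 = T • b 1 + (-N) • (1 : 𝓞 K) := by
      rw [h1, zsmul_eq_mul, zsmul_eq_mul]
      push_cast
      ring
    rw [this, map_add, map_zsmul, map_zsmul, ht0, ht1, smul_eq_mul, smul_eq_mul]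
    ring
  rw [← discr_eq_discr K b, Algebra.discr_def, Matrix.det_fin_two]
  simp only [Algebra.traceMatrix_apply, Algebra.traceForm_apply, h0, one_mul, mul_one, ht0, ht1,
    ht2]
  ring

variable (K) in
lemma exists_basis_discr : ∃ (b : Basis (Fin 2) ℤ (𝓞 K)) (T N : ℤ), b 0 = 1 ∧
    b 1 * b 1 = T * b 1 - N ∧ discr K = T ^ 2 - 4 * N := by
  obtain ⟨b, h0⟩ := exists_int_basis K
  have h := b.sum_repr (b 1 * b 1)
  rw [Fin.sum_univ_two, h0, zsmul_eq_mul, zsmul_eq_mul] at h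
  have h1 : b 1 * b 1 = (b.repr (b 1 * b 1) 1 : ℤ) * b 1 - ((-b.repr (b 1 * b 1) 0 : ℤ) : 𝓞 K) := by
    conv_lhs => rw [← h]
    push_cast
    ring
  exact ⟨b, _, _, h0, h1, discr_eq_of_basis b h0 h1⟩

lemma eq_add_of_basis (b : Basis (Fin 2) ℤ (𝓞 K)) (h0 : b 0 = 1) (y : 𝓞 K) :
    y = (b.repr y 0 : 𝓞 K) + (b.repr y 1 : 𝓞 K) * b 1 := by
  conv_lhs => rw [← b.sum_repr y]
  rw [Fin.sum_univ_two, h0, zsmul_eq_mul, zsmul_eq_mul, mul_one]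

lemma repr_of_basis (b : Basis (Fin 2) ℤ (𝓞 K)) (h0 : b 0 = 1) (x y : ℤ) :
    b.repr ((x : 𝓞 K) + (y : 𝓞 K) * b 1) 0 = x ∧ b.repr ((x : 𝓞 K) + (y : 𝓞 K) * b 1) 1 = y := by
  have : (x : 𝓞 K) + (y : 𝓞 K) * b 1 = x • b 0 + y • b 1 := by
    rw [h0, zsmul_eq_mul, zsmul_eq_mul, mul_one]
  rw [this, map_add, map_smul, map_smul, b.repr_self, b.repr_self]
  simp

/-- Ring homomorphisms from the ring of integers of a quadratic field with basis `1, ω` correspond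
to the roots of the polynomial of `ω`. -/
lemma exists_ringHom_of_root (b : Basis (Fin 2) ℤ (𝓞 K)) (h0 : b 0 = 1) {T N : ℤ}
    (h1 : b 1 * b 1 = T * b 1 - N) {R : Type*} [CommRing R] {r : R} (hr : r * r = T * r - N) :
    ∃ g : 𝓞 K →+* R, g (b 1) = r := by
  let g : 𝓞 K →+ R :=
    { toFun := fun y => (b.repr y 0 : R) + (b.repr y 1 : R) * r
      map_zero' := by simp
      map_add' := fun x y => by
        simp only [map_add, Finsupp.add_apply]
        push_cast
        ring }
  have hg : ∀ x y : ℤ, g ((x : 𝓞 K) + (y : 𝓞 K) * b 1) = (x : R) + (y : R) * r := fun x y => by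
    change ((b.repr _ 0 : ℤ) : R) + ((b.repr _ 1 : ℤ) : R) * r = _
    rw [(repr_of_basis b h0 x y).1, (repr_of_basis b h0 x y).2]
  have hg1 : g 1 = 1 := by simpa using hg 1 0
  have hmul : ∀ x y, g (x * y) = g x * g y := fun x y => by
    rw [eq_add_of_basis b h0 x, eq_add_of_basis b h0 y]
    generalize b.repr x 0 = x0, b.repr x 1 = x1, b.repr y 0 = y0, b.repr y 1 = y1
    have : ((x0 : 𝓞 K) + x1 * b 1) * (y0 + y1 * b 1) =
        ((x0 * y0 - N * x1 * y1 : ℤ) : 𝓞 K) + ((x0 * y1 + x1 * y0 + T * x1 * y1 : ℤ)) * b 1 := by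
      push_cast
      linear_combination (x1 : 𝓞 K) * y1 * h1
    rw [this, hg, hg, hg]
    push_cast
    linear_combination -(x1 : R) * y1 * hr
  refine ⟨⟨⟨⟨g, hg1⟩, hmul⟩, g.map_zero, g.map_add⟩, ?_⟩
  change g (b 1) = r
  simpa using hg 0 1

lemma ringHom_ext_of_basis (b : Basis (Fin 2) ℤ (𝓞 K)) (h0 : b 0 = 1) {R : Type*} [CommRing R]
    {g g' : 𝓞 K →+* R} (h : g (b 1) = g' (b 1)) : g = g' := by
  ext y
  rw [eq_add_of_basis b h0 y]
  simp [h]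

/-- The primes of norm `p` correspond to roots modulo `p`. -/
lemma ncard_absNorm_eq (b : Basis (Fin 2) ℤ (𝓞 K)) (h0 : b 0 = 1) {T N : ℤ}
    (h1 : b 1 * b 1 = T * b 1 - N) {p : ℕ} (hp : p.Prime) :
    {P : Ideal (𝓞 K) | Ideal.absNorm P = p}.ncard =
      {r : ZMod p | r * r = T * r - N}.ncard := by
  have hroot : ∀ r : {r : ZMod p | r * r = T * r - N}, ∃ g : 𝓞 K →+* ZMod p, g (b 1) = r :=
    fun r => exists_ringHom_of_root b h0 h1 r.2
  choose g hg using hroot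
  have hker : ∀ f : 𝓞 K →+* ZMod p, Ideal.absNorm (RingHom.ker f) = p := fun f => by
    have e := RingHom.quotientKerEquivOfSurjective (ZMod.ringHom_surjective f)
    exact (Nat.card_congr e.toEquiv).trans (Nat.card_zmod p)
  -- A root `r` goes to the kernel of $\omega\mapsto r$. The kernel determines `r`, as it contains
  -- $\omega$ minus a lift of `r`; conversely the quotient by an ideal of norm $p$ is $\mathbb Z/p$,
  -- and the image of $\omega$ is a root.
  refine (Nat.card_congr (Equiv.ofBijective
    (fun r => (⟨RingHom.ker (g r), hker _⟩ : {P : Ideal (𝓞 K) | Ideal.absNorm P = p}))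
      ⟨fun r r' h => ?_, fun P => ?_⟩)).symm
  · have h2 : RingHom.ker (g r) = RingHom.ker (g r') := congrArg Subtype.val h
    have h3 : b 1 - (((r : ZMod p).val : ℤ) : 𝓞 K) ∈ RingHom.ker (g r) := by
      have : NeZero p := ⟨hp.ne_zero⟩
      rw [RingHom.mem_ker, map_sub, map_intCast, hg]
      simp
    rw [h2, RingHom.mem_ker, map_sub, map_intCast, hg] at h3
    have : NeZero p := ⟨hp.ne_zero⟩
    refine Subtype.ext ?_
    have h4 := sub_eq_zero.mp h3
    simp at h4
    exact h4.symm
  · obtain ⟨P, hP⟩ := P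
    have hcard : Nat.card (𝓞 K ⧸ P) = p := hP
    have : Finite (𝓞 K ⧸ P) := Nat.finite_of_card_ne_zero (by rw [hcard]; exact hp.ne_zero)
    let _ := Fintype.ofFinite (𝓞 K ⧸ P)
    let e := ZMod.ringEquivOfPrime (𝓞 K ⧸ P) hp (by rw [← Nat.card_eq_fintype_card, hcard])
    let f : 𝓞 K →+* ZMod p := e.symm.toRingHom.comp (Ideal.Quotient.mk P)
    have hf : RingHom.ker f = P := by
      ext x
      simp [f, RingHom.mem_ker, Ideal.Quotient.eq_zero_iff_mem]
    have hr : f (b 1) ∈ {r : ZMod p | r * r = T * r - N} := by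
      change f (b 1) * f (b 1) = T * f (b 1) - N
      rw [← map_mul, h1]
      simp
    refine ⟨⟨f (b 1), hr⟩, Subtype.ext ?_⟩
    change RingHom.ker (g _) = P
    rw [ringHom_ext_of_basis b h0 (hg ⟨f (b 1), hr⟩), hf]

lemma ncard_roots_two (t n : ZMod 2) :
    {r : ZMod 2 | r * r = t * r - n}.ncard = if t = 0 then 1 else if n = 0 then 2 else 0 := by
  rw [Set.ncard_eq_toFinset_card']
  revert t n
  decide

/-- The number of roots of `X² - TX + N` modulo a prime. -/
lemma ncard_roots (T N : ℤ) {p : ℕ} (hp : p.Prime) :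
    ({r : ZMod p | r * r = T * r - N}.ncard : ℤ) = kroneckerPrime (T ^ 2 - 4 * N) p + 1 := by
  have := Fact.mk hp
  rw [kroneckerPrime]
  by_cases hp2 : p = 2
  · subst hp2
    rw [if_pos rfl, ncard_roots_two]
    have hN : (N : ZMod 2) = 0 ↔ N % 2 = 0 := by
      rw [ZMod.intCast_zmod_eq_zero_iff_dvd, Int.dvd_iff_emod_eq_zero]
      rfl
    have hT : (T : ZMod 2) = 0 ↔ T % 2 = 0 := by
      rw [ZMod.intCast_zmod_eq_zero_iff_dvd, Int.dvd_iff_emod_eq_zero]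
      rfl
    simp only [hT, hN]
    rcases Int.emod_two_eq_zero_or_one T with h | h
    · have h2 : T ^ 2 % 2 = 0 := by simp [pow_two, Int.mul_emod, h]
      rw [if_pos h, if_pos (by omega)]
      rfl
    · have h8 : T ^ 2 % 8 = 1 := by
        have : T % 8 = 1 ∨ T % 8 = 3 ∨ T % 8 = 5 ∨ T % 8 = 7 := by omega
        rcases this with h | h | h | h <;> simp [pow_two, Int.mul_emod, h]
      rw [if_neg (by omega : ¬ T % 2 = 0), if_neg (by omega : ¬ (T ^ 2 - 4 * N) % 2 = 0)]
      by_cases hN2 : N % 2 = 0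
      · rw [if_pos hN2, if_pos (by omega)]
        rfl
      · rw [if_neg hN2, if_neg (by omega)]
        rfl
  · rw [if_neg hp2, ← jacobiSym.legendreSym.to_jacobiSym, ← legendreSym.card_sqrts p hp2,
      ← Set.ncard_eq_toFinset_card']
    congr 1
    have h2 : (2 : ZMod p) ≠ 0 := by
      rw [Ne, ← Nat.cast_ofNat, ZMod.natCast_eq_zero_iff, Nat.prime_dvd_prime_iff_eq hp Nat.prime_two]
      exact hp2
    -- Completing the square: for odd $p$, $r\mapsto 2r-T$ carries roots to square roots of the
    -- discriminant.
    refine Set.ncard_congr (fun r _ => 2 * r - T) (fun r hr => ?_) (fun r s _ _ h => ?_)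
      fun s hs => ?_
    · have hr' : r * r = T * r - N := hr
      change (2 * r - (T : ZMod p)) ^ 2 = _
      push_cast
      linear_combination 4 * hr'
    · exact mul_left_cancel₀ h2 (sub_left_injective h)
    · have hs' : s ^ 2 = ((T ^ 2 - 4 * N : ℤ) : ZMod p) := hs
      push_cast at hs'
      refine ⟨(s + T) / 2, ?_, by field_simp; ring⟩
      change (s + T) / 2 * ((s + T) / 2) = T * ((s + T) / 2) - N
      field_simp
      linear_combination hs'

end QuadraticField

end CMClassNumber

namespace CMClassNumber

open Filter

/-! ### Dirichlet's class number formula for imaginary quadratic fields -/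

section ImaginaryQuadratic

lemma absNorm_eq_natGenerator (𝔭 : HeightOneSpectrum (𝓞 ℚ)) :
    Ideal.absNorm 𝔭.asIdeal = Rat.HeightOneSpectrum.natGenerator 𝔭 := by
  have h := Rat.HeightOneSpectrum.span_natGenerator 𝔭
  have h1 : Ideal.absNorm 𝔭.asIdeal =
      Ideal.absNorm (Ideal.span {(Rat.HeightOneSpectrum.natGenerator 𝔭 : ℤ)}) :=
    Nat.card_congr (Ideal.quotientEquiv _ _ (Rat.IsIntegralClosure.intEquiv (𝓞 ℚ)) h).toEquiv
  rw [h1, Ideal.absNorm_span_singleton]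
  simp

variable (K : Type*) [Field K] [NumberField K] [Algebra.IsQuadraticExtension ℚ K]

lemma mem_primesOver_of_absNorm_eq {𝔭 : HeightOneSpectrum (𝓞 ℚ)} {P : Ideal (𝓞 K)}
    (hP : Ideal.absNorm P = Ideal.absNorm 𝔭.asIdeal) : P ∈ 𝔭.asIdeal.primesOver (𝓞 K) := by
  have hp := Rat.HeightOneSpectrum.prime_natGenerator 𝔭
  have hp' := absNorm_eq_natGenerator 𝔭
  have hprime : P.IsPrime := Ideal.isPrime_of_irreducible_absNorm (by rw [hP, hp']; exact hp)
  refine ⟨hprime, ⟨?_⟩⟩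
  refine 𝔭.isMaximal.eq_of_le (Ideal.IsPrime.under (𝓞 ℚ) P).ne_top fun x hx => ?_
  rw [Ideal.mem_comap]
  let e := Rat.IsIntegralClosure.intEquiv (𝓞 ℚ)
  have h1 : e x ∈ Ideal.span {(Rat.HeightOneSpectrum.natGenerator 𝔭 : ℤ)} := by
    rw [Rat.HeightOneSpectrum.span_natGenerator]
    exact Ideal.mem_map_of_mem _ hx
  obtain ⟨y, hy⟩ := Ideal.mem_span_singleton.mp h1
  have h2 : x = (Ideal.absNorm P : 𝓞 ℚ) * e.symm y := by
    apply e.injective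
    rw [hy, map_mul, hP, hp', map_natCast, e.apply_symm_apply]
  rw [h2, map_mul, map_natCast]
  exact Ideal.mul_mem_right _ _ (Ideal.absNorm_mem P)

/-- The quadratic Hecke character of a quadratic field is the Kronecker symbol. -/
theorem heckeChar_eq_kroneckerPrime (𝔭 : HeightOneSpectrum (𝓞 ℚ)) :
    heckeChar K 𝔭 = (kroneckerPrime (discr K) (Rat.HeightOneSpectrum.natGenerator 𝔭) : ℂ) := by
  have hp := Rat.HeightOneSpectrum.prime_natGenerator 𝔭
  have hp' := absNorm_eq_natGenerator 𝔭
  set p := Rat.HeightOneSpectrum.natGenerator 𝔭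
  obtain ⟨b, T, N, h0, h1, hD⟩ := exists_basis_discr K
  have hcard := ncard_roots T N hp
  rw [← ncard_absNorm_eq b h0 h1 hp, ← hD] at hcard
  -- The symbol is one less than the number of primes of norm $p$, and that number is $2$, $0$ or
  -- $1$ in the split, inert and ramified cases.
  have hk : (kroneckerPrime (discr K) p : ℂ) =
      ({P : Ideal (𝓞 K) | Ideal.absNorm P = p}.ncard : ℂ) - 1 := by
    rw [eq_sub_iff_add_eq]
    exact_mod_cast hcard.symm
  obtain ⟨f, hf, h⟩ := decomposition K 𝔭
  rw [hp'] at hf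
  have hsub : {P : Ideal (𝓞 K) | Ideal.absNorm P = p} ⊆ 𝔭.asIdeal.primesOver (𝓞 K) :=
    fun P hP => mem_primesOver_of_absNorm_eq K (by rw [hp']; exact hP)
  have heq : f = 1 → {P : Ideal (𝓞 K) | Ideal.absNorm P = p} = 𝔭.asIdeal.primesOver (𝓞 K) :=
    fun hf1 => hsub.antisymm fun P hP => by
      have := hf P hP
      rwa [hf1, pow_one] at this
  rcases h with ⟨hc, hf1, hn⟩ | ⟨hc, hf2, hn⟩ | ⟨hc, hf1, hn⟩
  · rw [hk, heq hf1, hn, hc]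
    norm_num
  · have : {P : Ideal (𝓞 K) | Ideal.absNorm P = p} = ∅ := by
      rw [Set.eq_empty_iff_forall_notMem]
      intro P hP
      have h2 := hf P (hsub hP)
      rw [hf2, (hP : Ideal.absNorm P = p)] at h2
      have := hp.one_lt
      nlinarith
    rw [hk, this, hc]
    simp
  · rw [hk, heq hf1, hn, hc]
    norm_num

lemma kronecker_prime (D : ℤ) {p : ℕ} (hp : p.Prime) : kronecker D p = kroneckerPrime D p := by
  simp [kronecker, Nat.primeFactorsList_prime hp]

lemma heckeL_eq_LFunction {χ : DirichletCharacter ℂ (discr K).natAbs}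
    (hχ : ∀ n : ℕ, 1 ≤ n → χ n = (kronecker (discr K) n : ℂ)) {s : ℂ} (hs : 1 < s.re) :
    heckeL ℚ K s = χ.LFunction s := by
  rw [DirichletCharacter.LFunction_eq_LSeries χ hs]
  have h := DirichletCharacter.LSeries_eulerProduct_hasProd χ hs
  rw [← Rat.HeightOneSpectrum.primesEquiv (R := 𝓞 ℚ).hasProd_iff] at h
  rw [← h.tprod_eq]
  refine tprod_congr fun 𝔭 => ?_
  have hp := Rat.HeightOneSpectrum.prime_natGenerator 𝔭
  change _ = (1 - χ (Rat.HeightOneSpectrum.natGenerator 𝔭 : ℕ) *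
    (Rat.HeightOneSpectrum.natGenerator 𝔭 : ℂ) ^ (-s))⁻¹
  rw [eulerFactor, heckeChar_eq_kroneckerPrime, absNorm_eq_natGenerator, hχ _ hp.one_le,
    kronecker_prime _ hp]

lemma LFunction_one_eq {χ : DirichletCharacter ℂ (discr K).natAbs}
    (hχ : ∀ n : ℕ, 1 ≤ n → χ n = (kronecker (discr K) n : ℂ)) :
    χ.LFunction 1 = heckeLOne ℚ K := by
  have hlim := tendsto_heckeL ℚ K
  have heq : (fun s : ℝ => heckeL ℚ K s) =ᶠ[𝓝[>] 1] fun s : ℝ => χ.LFunction s := by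
    filter_upwards [self_mem_nhdsWithin] with s hs
    exact heckeL_eq_LFunction K hχ (by simpa using hs)
  rw [← heckeLOne_eq] at hlim
  replace hlim := hlim.congr' heq
  have hcoe : Tendsto (fun s : ℝ => (s : ℂ)) (𝓝[>] 1) (𝓝 1) := by
    have := (Complex.continuous_ofReal.tendsto 1).mono_left (nhdsWithin_le_nhds (s := Set.Ioi 1))
    simpa using this
  -- The trivial character has residue $\prod_{p\mid\Delta_K}(1-p^{-1})\neq0$ at $1$, whereas
  -- $L(s,\chi)$ has a finite limit there. So $\chi\neq1$, and its $L$-function is continuous at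
  -- $1$.
  have hχ1 : χ ≠ 1 := by
    rintro rfl
    have h1 := DirichletCharacter.LFunctionTrivChar_residue_one (N := (discr K).natAbs)
    have hcoe' : Tendsto (fun s : ℝ => (s : ℂ)) (𝓝[>] 1) (𝓝[≠] 1) := by
      refine tendsto_nhdsWithin_iff.mpr ⟨hcoe, ?_⟩
      filter_upwards [self_mem_nhdsWithin] with s hs
      have : s ≠ 1 := (Set.mem_Ioi.mp hs).ne'
      simpa using this
    have h2 := h1.comp hcoe'
    have h3 : Tendsto (fun s : ℝ => ((s : ℂ) - 1) *
        DirichletCharacter.LFunction (1 : DirichletCharacter ℂ (discr K).natAbs) s)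
        (𝓝[>] 1) (𝓝 0) := by
      simpa using (hcoe.sub_const 1).mul hlim
    have h4 := tendsto_nhds_unique h2 h3
    rw [Finset.prod_eq_zero_iff] at h4
    obtain ⟨p, hp, h5⟩ := h4
    have hp1 := (Nat.prime_of_mem_primeFactors hp).one_lt
    rw [sub_eq_zero, eq_comm, inv_eq_one] at h5
    have : p = 1 := by exact_mod_cast h5
    omega
  exact tendsto_nhds_unique
    (((DirichletCharacter.differentiable_LFunction hχ1).continuous.tendsto 1).comp hcoe) hlim

variable [IsTotallyComplex K]

lemma nrComplexPlaces_eq_one : InfinitePlace.nrComplexPlaces K = 1 := by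
  have h := InfinitePlace.card_add_two_mul_card_eq_rank K
  rw [IsTotallyComplex.nrRealPlaces_eq_zero, Algebra.IsQuadraticExtension.finrank_eq_two] at h
  omega

lemma discr_neg : discr K < 0 := by
  have h := sign_discr K
  rw [nrComplexPlaces_eq_one, pow_one] at h
  exact Int.sign_eq_neg_one_iff_neg.mp h

/-- The unit rank is zero, so every unit is a root of unity. -/
lemma unitIndex_rat : unitIndex ℚ K = 1 := by
  have hrank : Units.rank K = 0 := by
    rw [Units.rank, InfinitePlace.card_eq_nrRealPlaces_add_nrComplexPlaces,
      nrComplexPlaces_eq_one, IsTotallyComplex.nrRealPlaces_eq_zero]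
  have htop : Units.torsion K = ⊤ := by
    rw [eq_top_iff]
    rintro x -
    obtain ⟨⟨ζ, e⟩, h, -⟩ := Units.exist_unique_eq_mul_prod K x
    have : IsEmpty (Fin (Units.rank K)) := by
      rw [hrank]
      infer_instance
    rw [Fintype.prod_empty, mul_one] at h
    rw [h]
    exact ζ.2
  rw [unitIndex, htop, top_sup_eq, Subgroup.index_top]

theorem exists_dirichletCharacter_classNumber_eq :
    ∃ χ : DirichletCharacter ℂ (discr K).natAbs,
      (∀ n : ℕ, 1 ≤ n → χ n = (kronecker (discr K) n : ℂ)) ∧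
      χ.LFunction 1 = heckeLOne ℚ K ∧
      (classNumber K : ℂ) =
        ((Units.torsionOrder K * √(|discr K| : ℝ) / (2 * Real.pi) : ℝ) : ℂ) *
          χ.LFunction 1 := by
  -- Stickelberger's congruence, from $\Delta_K=T^2-4N$.
  have h4 : discr K % 4 = 0 ∨ discr K % 4 = 1 := by
    obtain ⟨b, T, N, -, -, hD⟩ := exists_basis_discr K
    rw [hD]
    rcases Int.emod_two_eq_zero_or_one T with h | h
    · have : T ^ 2 % 4 = 0 := by
        obtain ⟨t, rfl⟩ := Int.dvd_of_emod_eq_zero h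
        rw [mul_pow]
        omega
      omega
    · have : T ^ 2 % 4 = 1 := Int.sq_mod_four_eq_one_of_odd (Int.odd_iff.mpr h)
      omega
  obtain ⟨χ, hχ⟩ := exists_dirichletCharacter_eq_kronecker (discr_neg K) h4 rfl
  refine ⟨χ, hχ, LFunction_one_eq K hχ, ?_⟩
  rw [LFunction_one_eq K hχ, classNumber_formula ℚ K (N := |(discr K : ℝ)|)
    (abs_pos.mpr (by exact_mod_cast discr_ne_zero K)) (by rw [discr_rat]; simp)]
  rw [Rat.classNumber_eq, unitIndex_rat, discr_rat, finrank_self]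
  simp

lemma absNorm_assocIdeal_rat : FractionalIdeal.absNorm (assocIdeal (detH ℚ K)) = |discr K| := by
  have := (absNorm_assocIdeal_detH ℚ K).2
  rw [discr_rat, Int.cast_one, one_pow, mul_one] at this
  exact_mod_cast this.symm

end ImaginaryQuadratic

end CMClassNumber

theorem mainTheorem6 :
    (∀ (F : Type*) (K : Type*) [Field F] [NumberField F] [Field K] [NumberField K]
      [Algebra F K] [IsTotallyReal F] [IsTotallyComplex K] [Algebra.IsQuadraticExtension F K],
      SplitsCompletely 2 F →
        unitIndex F K ∈ ({1, 2} : Set ℕ) ∧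
        (∀ s : ℂ, 1 < s.re →
          Multipliable fun 𝔭 : IsDedekindDomain.HeightOneSpectrum (𝓞 F) => eulerFactor K s 𝔭) ∧
        Tendsto (fun s : ℝ => heckeL F K (s : ℂ)) (𝓝[>] 1) (𝓝 (heckeLOne F K)) ∧
        (classNumber K : ℂ) =
          ((Units.torsionOrder K * classNumber F * √(|discr F| : ℝ) * unitIndex F K *
            √(FractionalIdeal.absNorm (assocIdeal (detH F K)) : ℝ) /
              (2 * Real.pi) ^ Module.finrank ℚ F : ℝ) : ℂ) * heckeLOne F K) ∧
    (∀ (K : Type*) [Field K] [NumberField K] [IsTotallyComplex K]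
      [Algebra.IsQuadraticExtension ℚ K],
      classNumber ℚ = 1 ∧ unitIndex ℚ K = 1 ∧
      FractionalIdeal.absNorm (assocIdeal (detH ℚ K)) = |discr K| ∧
      ∃ χ : DirichletCharacter ℂ (discr K).natAbs,
        (∀ n : ℕ, 1 ≤ n → χ n = (kronecker (discr K) n : ℂ)) ∧
        χ.LFunction 1 = heckeLOne ℚ K ∧
        (classNumber K : ℂ) =
          ((Units.torsionOrder K * √(|discr K| : ℝ) / (2 * Real.pi) : ℝ) : ℂ) *
            χ.LFunction 1) := by
  refine ⟨fun F K _ _ _ _ _ _ _ _ _ => ⟨unitIndex_mem F K, fun s hs =>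
    (hasProd_eulerFactor F K hs).multipliable, ?_, ?_⟩, fun K _ _ _ _ =>
    ⟨Rat.classNumber_eq, unitIndex_rat K, absNorm_assocIdeal_rat K,
      exists_dirichletCharacter_classNumber_eq K⟩⟩
  · rw [heckeLOne_eq]
    exact tendsto_heckeL F K
  · obtain ⟨h0, h⟩ := absNorm_assocIdeal_detH F K
    exact classNumber_formula F K (by exact_mod_cast h0) (by exact_mod_cast h)
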